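/- Let $\mathcal M\subset\mathbb R^N$ be a compact smooth embedded submanifold of dimension $d$, with volume measure $\mathrm dx$ (the $d$-dimensional Hausdorff measure, normalised so that it is Lebesgue measure on $\mathbb R^d$). Let $\{(U_j,\phi_j)\}_{j\in J}$ be a finite atlas: the sets $U_j\subset\mathcal M$ are open and cover $\mathcal M$, and each $\phi_j$ is a homeomorphism of $U_j$ onto a bounded open set $\phi_j(U_j)\subset\mathbb R^d$. Let $\{\eta_j\}_{j\in J}$ be a partition of unity on $\mathcal M$ with $\mathrm{supp}(\eta_j)\subset U_j$. Let $f\in C(\mathcal M)$, and put $\hat f_j:=(f\,\eta_j)\circ\phi_j^{-1}$ on $\phi_j(U_j)$ and $\hat f_j:=0$ elsewhere in $\mathbb R^d$. Let $\rho\in L^1(\mathbb R)\cap L^2(\mathbb R)$ be an activation function that is not almost everywhere zero. Write $\mathrm{rad}(S):=\sup_{z\in S}\|z\|_2$. For every $\varepsilon>0$ there are constants $\alpha_j,\Omega_j>0$ $(j\in J)$ such that the following holds. Suppose that for $j\in J$ and $k\in\mathbb N$ the random variables $$w_k^{(j)}\sim\mathrm{Unif}\big([-\alpha_j\Omega_j,\alpha_j\Omega_j]^d\big),\qquad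 y_k^{(j)}\sim\mathrm{Unif}(\phi_j(U_j)),\qquad u_k^{(j)}\sim\mathrm{Unif}\big([-\tfrac{\pi}{2}(2L_j+1),\tfrac{\pi}{2}(2L_j+1)]\big),$$ where $L_j:=\lceil\tfrac{2d}{\pi}\mathrm{rad}(\phi_j(U_j))\Omega_j-\tfrac12\rceil$, are all mutually independent, and put $b_k^{(j)}:=-\langle w_k^{(j)},y_k^{(j)}\rangle-\alpha_ju_k^{(j)}$. Then there are hidden-to-output weights $v_k^{(j)}=v_{k,n_j}^{(j)}\in\mathbb R$, $1\le k\le n_j$, which are measurable functions of the weights and biases $\big(w_i^{(j)},b_i^{(j)}\big)_{i=1}^{n_j}$ of the same chart, such that the RVFL networks $$\tilde f_{n_j}(z):=\sum_{k=1}^{n_j}v_k^{(j)}\,\rho\big(\langle w_k^{(j)},z\rangle+b_k^{(j)}\big),\qquad z\in\phi_j(U_j),$$ have the following two properties (the functions $v_{k,n}^{(j)}$ do not depend on the choice of the probability space). 1. For each $j\in J$, $\tilde f_{n_j}$ approximates $\hat f_j$: the squared error $|\hat f_j-\tilde f_{n_j}|^2$ is integrable for the product of the probability measure and Lebesgue measure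 on $\phi_j(U_j)$, and the limit $$\lim_{n_j\to\infty}\mathbb E\int_{\phi_j(U_j)}\big|\hat f_j(z)-\tilde f_{n_j}(z)\big|^2\,\mathrm dz$$ exists and is $<\varepsilon$, with convergence to this limit at rate $O(1/n_j)$. 2. The squared error $\big|f(x)-\sum_{\{j\in J:\,x\in U_j\}}\tilde f_{n_j}(\phi_j(x))\big|^2$ is integrable for the product of the probability measure and the volume measure of $\mathcal M$, and, as all $n_j$ tend to infinity simultaneously, the limit $$\lim_{\{n_j\}_{j\in J}\to\infty}\mathbb E\int_{\mathcal M}\Big|f(x)-\sum_{\{j\in J:\,x\in U_j\}}\tilde f_{n_j}(\phi_j(x))\Big|^2\,\mathrm dx$$ exists and is $<\varepsilon$, with convergence to this limit at rate $O(1/\min_{j\in J}n_j)$. -/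

import Mathlib

open MeasureTheory ProbabilityTheory Filter Topology
open scoped Manifold ContDiff

noncomputable section

/-- Euclidean space `ℝ^d` with its Euclidean norm and inner product. -/
abbrev Euc (d : ℕ) : Type := EuclideanSpace ℝ (Fin d)

/-- The radius `rad(S) = sup_{x ∈ S} ‖x‖` of a (bounded) set. -/
def rad {d : ℕ} (S : Set (Euc d)) : ℝ := sSup ((fun x => ‖x‖) '' S)

/-- The integer `L = ⌈(2d/π) rad(S) Ω - 1/2⌉`. -/
def phaseIndex {d : ℕ} (S : Set (Euc d)) (Ω : ℝ) : ℤ :=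
  ⌈2 * (d : ℝ) / Real.pi * rad S * Ω - 1 / 2⌉

/-- The cube `[-r, r]^d`. -/
def cube (d : ℕ) (r : ℝ) : Set (Euc d) := {w | ∀ i, w i ∈ Set.Icc (-r) r}

/-- The interval `[-(π/2)(2L+1), (π/2)(2L+1)]`, with `L = ⌈(2d/π) rad(S) Ω - 1/2⌉`. -/
def phaseInterval {d : ℕ} (S : Set (Euc d)) (Ω : ℝ) : Set ℝ :=
  Set.Icc (-(Real.pi / 2 * (2 * (phaseIndex S Ω : ℝ) + 1)))
    (Real.pi / 2 * (2 * (phaseIndex S Ω : ℝ) + 1))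

/-- The uniform probability distribution on a set `S` with `0 < vol(S) < ∞`. -/
def unif {E : Type*} [MeasureSpace E] (S : Set E) : Measure E :=
  ProbabilityTheory.cond (volume : Measure E) S

/-- The joint law of one triple `(w, y, u)` of independent random variables with
`w ∼ Unif([-αΩ, αΩ]^d)`, `y ∼ Unif(S)` and `u ∼ Unif([-(π/2)(2L+1), (π/2)(2L+1)])`. -/
def sampleLaw {d : ℕ} (S : Set (Euc d)) (α Ω : ℝ) : Measure (Euc d × Euc d × ℝ) :=
  (unif (cube d (α * Ω))).prod ((unif S).prod (unif (phaseInterval S Ω)))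

/-- All the random variables `w j k`, `y j k`, `u j k` (for `j ∈ J` and `k ∈ ℕ`) are mutually
independent, with `w j k ∼ Unif([-α_j Ω_j, α_j Ω_j]^d)`, `y j k ∼ Unif(T j)` and
`u j k ∼ Unif([-(π/2)(2L_j+1), (π/2)(2L_j+1)])`: the triples are independent of each other, and
the law of each triple is the product of the three uniform distributions. -/
structure IsRandomSample {d : ℕ} {J S : Type*} [MeasurableSpace S] (P : Measure S)
    (T : J → Set (Euc d)) (α Ω : J → ℝ)
    (w y : J → ℕ → S → Euc d) (u : J → ℕ → S → ℝ) : Prop where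
  law : ∀ j k, HasLaw (fun s => (w j k s, y j k s, u j k s)) (sampleLaw (T j) (α j) (Ω j)) P
  indep : iIndepFun (fun (p : J × ℕ) (s : S) => (w p.1 p.2 s, y p.1 p.2 s, u p.1 p.2 s)) P

/-- The bias `b = -⟨w, y⟩ - α u`. -/
def bias {d : ℕ} (α : ℝ) (w y : Euc d) (u : ℝ) : ℝ := -(inner ℝ w y) - α * u

/-- A network with one hidden layer of `n` nodes, `z ↦ ∑_k v_k ρ(⟨w_k, z⟩ + b_k)`, given by its
input-to-hidden weights and biases `(w_k, b_k)` and its hidden-to-output weights `v_k`. -/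
def network {d n : ℕ} (ρ : ℝ → ℝ) (wb : Fin n → Euc d × ℝ) (v : Fin n → ℝ) (z : Euc d) : ℝ :=
  ∑ k, v k * ρ (inner ℝ (wb k).1 z + (wb k).2)

/-- The RVFL network with `n` nodes on one chart: the inner weights and biases are the first `n`
random samples, and the outer weights are a function `v` of those weights and biases. -/
def rvfl {d : ℕ} {S : Type*} (ρ : ℝ → ℝ) (α : ℝ) (w y : ℕ → S → Euc d) (u : ℕ → S → ℝ)
    (n : ℕ) (v : (Fin n → Euc d × ℝ) → Fin n → ℝ) (s : S) (z : Euc d) : ℝ :=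
  let wb : Fin n → Euc d × ℝ := fun k => (w k s, bias α (w k s) (y k s) (u k s))
  network ρ wb (v wb) z

open Classical in
/-- The chart function `f̂ = (f · η) ∘ φ⁻¹` on `φ(U)`, extended by zero to `ℝ^d`. -/
def chartFun {d : ℕ} {M : Type*} [TopologicalSpace M] (f η : M → ℝ)
    (φ : OpenPartialHomeomorph M (Euc d)) (z : Euc d) : ℝ :=
  if z ∈ φ.target then f (φ.symm z) * η (φ.symm z) else 0

open Classical in
/-- The sum `∑_{j : x ∈ U_j} g_j(φ_j(x))` over the charts whose domain contains `x`. -/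
def chartSum {d : ℕ} {M J : Type*} [TopologicalSpace M] [Fintype J]
    (φ : J → OpenPartialHomeomorph M (Euc d)) (g : J → Euc d → ℝ) (x : M) : ℝ :=
  ∑ j ∈ Finset.univ.filter (fun j => x ∈ (φ j).source), g j (φ j x)

/-- The squared error `|f̂(z) - f̃_n(z)|²` of one network at `z`, for the outcome `s`. -/
def chartSqError {d : ℕ} {S : Type*} (ρ : ℝ → ℝ) (α : ℝ) (w y : ℕ → S → Euc d) (u : ℕ → S → ℝ)
    (n : ℕ) (v : (Fin n → Euc d × ℝ) → Fin n → ℝ) (fhat : Euc d → ℝ) (s : S) (z : Euc d) : ℝ :=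
  |fhat z - rvfl ρ α w y u n v s z| ^ 2

/-- The squared error `|f(x) - ∑_{j : x ∈ U_j} f̃_{n_j}(φ_j(x))|²` at the point `x` of `M`, for the
outcome `s`. -/
def manifoldSqError {d : ℕ} {M J S : Type*} [TopologicalSpace M] [Fintype J]
    (φ : J → OpenPartialHomeomorph M (Euc d)) (ρ : ℝ → ℝ) (α : J → ℝ)
    (w y : J → ℕ → S → Euc d) (u : J → ℕ → S → ℝ) (n : J → ℕ)
    (v : (j : J) → (Fin (n j) → Euc d × ℝ) → Fin (n j) → ℝ) (f : M → ℝ) (s : S) (x : M) : ℝ :=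
  |f x - chartSum φ (fun j => rvfl ρ (α j) (w j) (y j) (u j) (n j) (v j) s) x| ^ 2

/-- The error `e i` has a limit along `l` that is smaller than `ε`, and it converges to this limit
at the rate `O(r i)`. -/
def TendstoBelowAtRate {ι : Type*} (l : Filter ι) (e r : ι → ℝ) (ε : ℝ) : Prop :=
  ∃ c < ε, Tendsto e l (𝓝 c) ∧ (fun i => e i - c) =O[l] r

end

/-! With outer weights g(w_k, b_k)/n for a fixed bounded g, the network is a Monte Carlo estimator:
its mean at z is the integral of g(w, b) ρ(⟨w, z⟩ + b) against the law Q of (w, b). By independence,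
the mean squared error at z is the squared bias, which does not depend on n, plus a variance of size
O(1/n). The limit is therefore the integrated squared bias, and the variance gives the rate.

Bias. As ρ is integrable and nonzero, its Fourier transform is nonzero at some frequency ξ ≠ 0, so
integrating translates of ρ against a bounded trigonometric weight yields cos(ξs + c) exactly.
Truncating in b and averaging over a small ball in w makes the weight bounded with bounded support
(`ridgeApprox_cos`), and Stone–Weierstrass passes from plane waves to all continuous functions on
compacts (`ridgeApprox_of_continuous`). The choice of L makes the density of Q constant for w in the
cube and moderate b (`innerLaw_restrict_eq`). A large α puts the support of the weight into this
region, and dividing by the density turns the superposition into an expectation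
(`exists_outer_weight`).

Variance. Q is dominated by a finite measure in w times Lebesgue measure in b. The shear (w, b) ↦
(w, ⟨w, z⟩ + b) preserves such products, so the second moment of a node is bounded uniformly in z by
a multiple of ‖ρ‖₂².

On the manifold, f is the sum of its chart functions, the chart biases add up, and the volume is
finite by compactness; `sampleMean_error` covers both parts of the theorem. -/

/-! ### Fourier analysis of the activation function -/

/-- A smooth compactly supported test function is the Fourier transform of a Schwartz function H.
Moving the transform from H onto ρ shows that ρ integrates to zero against it. -/
theorem ae_eq_zero_of_fourier_eq_zero {ρ : ℝ → ℂ} (hρ : Integrable ρ)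
    (h : ∀ᵐ ξ, FourierTransform.fourier ρ ξ = 0) : ρ =ᵐ[volume] 0 := by
  refine ae_eq_zero_of_integral_contDiff_smul_eq_zero hρ.locallyIntegrable fun g hg hgc => ?_
  have hg' : HasCompactSupport (fun x => (g x : ℂ)) :=
    hgc.comp_left (g := fun x : ℝ => (x : ℂ)) rfl
  let G : SchwartzMap ℝ ℂ := hg'.toSchwartzMap (Complex.ofRealCLM.contDiff.comp hg)
  let H : SchwartzMap ℝ ℂ := FourierTransform.fourierInv G
  have hH : FourierTransform.fourier (H : ℝ → ℂ) = G := by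
    rw [← SchwartzMap.fourier_coe]
    simp [H]
  have key := VectorFourier.integral_fourierIntegral_smul_eq_flip (L := innerₗ ℝ)
    Real.continuous_fourierChar continuous_inner hρ H.integrable (μ := volume) (ν := volume)
  have e1 : ∀ x, (g x) • ρ x = ρ x • (FourierTransform.fourier (H : ℝ → ℂ) x) := by
    intro x
    rw [hH]
    change _ = ρ x • ((g x : ℝ) : ℂ)
    simp [mul_comm]
  simp_rw [e1]
  rw [flip_innerₗ] at key
  refine key.symm.trans (integral_eq_zero_of_ae ?_)
  filter_upwards [h] with ξ hξ
  change FourierTransform.fourier ρ ξ • H ξ = 0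
  rw [hξ, zero_smul]

/-- Otherwise the Fourier transform vanishes off the null set {0}. The frequency 0 is excluded
because it would produce only constants. -/
theorem exists_cos_sin_integral_ne_zero {ρ : ℝ → ℝ} (hρ : Integrable ρ)
    (hρ0 : ¬ ρ =ᵐ[volume] 0) :
    ∃ ξ : ℝ, ξ ≠ 0 ∧
      0 < (∫ t, ρ t * Real.cos (ξ * t)) ^ 2 + (∫ t, ρ t * Real.sin (ξ * t)) ^ 2 := by
  by_contra! hcon
  refine hρ0 ?_
  have hC : (fun t => (ρ t : ℂ)) =ᵐ[volume] 0 := by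
    refine ae_eq_zero_of_fourier_eq_zero hρ.ofReal ?_
    have h0 : ∀ᵐ ξ : ℝ, ξ ≠ 0 := by simp [ae_iff]
    filter_upwards [h0] with ξ hξ
    have h1 := hcon (2 * Real.pi * ξ) (by positivity)
    have hc : ∫ t, ρ t * Real.cos (2 * Real.pi * ξ * t) = 0 := by nlinarith
    have hs : ∫ t, ρ t * Real.sin (2 * Real.pi * ξ * t) = 0 := by nlinarith
    have ic : Integrable fun t => ρ t * Real.cos (2 * Real.pi * ξ * t) :=
      hρ.mul_bdd (c := 1) (by fun_prop) (ae_of_all _ fun t => Real.abs_cos_le_one _)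
    have is : Integrable fun t => ρ t * Real.sin (2 * Real.pi * ξ * t) :=
      hρ.mul_bdd (c := 1) (by fun_prop) (ae_of_all _ fun t => Real.abs_sin_le_one _)
    rw [Real.fourier_real_eq_integral_exp_smul]
    have e : ∀ t : ℝ, Complex.exp (↑(-2 * Real.pi * t * ξ) * Complex.I) • (ρ t : ℂ)
        = ((ρ t * Real.cos (2 * Real.pi * ξ * t) : ℝ) : ℂ)
          - ((ρ t * Real.sin (2 * Real.pi * ξ * t) : ℝ) : ℂ) * Complex.I := by
      intro t
      rw [Complex.exp_mul_I, show -2 * Real.pi * t * ξ = -(2 * Real.pi * ξ * t) by ring,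
        ← Complex.ofReal_cos, ← Complex.ofReal_sin, Real.cos_neg, Real.sin_neg]
      push_cast
      simp only [smul_eq_mul]
      ring
    simp_rw [e]
    rw [integral_sub ic.ofReal (is.ofReal.mul_const _), integral_mul_const, integral_complex_ofReal,
      integral_complex_ofReal, hc, hs]
    simp
  filter_upwards [hC] with t ht
  simpa using ht

/-- A bounded continuous weight that recovers a plane wave from the translates of `ρ`. -/
theorem exists_weight_cos {ρ : ℝ → ℝ} (hρ : Integrable ρ) (hρ0 : ¬ ρ =ᵐ[volume] 0) :
    ∃ ξ : ℝ, ξ ≠ 0 ∧ ∀ c : ℝ, ∃ (γ : ℝ → ℝ) (C : ℝ), Continuous γ ∧ (∀ b, |γ b| ≤ C) ∧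
      ∀ s, ∫ b, γ b * ρ (s + b) = Real.cos (ξ * s + c) := by
  obtain ⟨ξ, hξ, hpos⟩ := exists_cos_sin_integral_ne_zero hρ hρ0
  refine ⟨ξ, hξ, fun c => ?_⟩
  set a₁ := ∫ t, ρ t * Real.cos (ξ * t) with ha₁
  set a₂ := ∫ t, ρ t * Real.sin (ξ * t) with ha₂
  -- After the shift t = s + b, with θ = ξs + c, the integral of the numerator is a₁(a₁ cos θ + a₂
  -- sin θ) + a₂(a₂ cos θ − a₁ sin θ) = (a₁² + a₂²) cos θ.
  refine ⟨fun b => (a₁ * Real.cos (ξ * b - c) + a₂ * Real.sin (ξ * b - c)) / (a₁ ^ 2 + a₂ ^ 2),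
    (|a₁| + |a₂|) / (a₁ ^ 2 + a₂ ^ 2), by fun_prop, fun b => ?_, fun s => ?_⟩
  · rw [abs_div, abs_of_pos hpos]
    gcongr
    refine (abs_add_le _ _).trans ?_
    rw [abs_mul, abs_mul]
    gcongr
    · exact mul_le_of_le_one_right (abs_nonneg _) (Real.abs_cos_le_one _)
    · exact mul_le_of_le_one_right (abs_nonneg _) (Real.abs_sin_le_one _)
  · have ic : Integrable fun t => ρ t * Real.cos (ξ * t) :=
      hρ.mul_bdd (c := 1) (by fun_prop) (ae_of_all _ fun t => Real.abs_cos_le_one _)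
    have is : Integrable fun t => ρ t * Real.sin (ξ * t) :=
      hρ.mul_bdd (c := 1) (by fun_prop) (ae_of_all _ fun t => Real.abs_sin_le_one _)
    have shift := integral_add_left_eq_self (μ := (volume : Measure ℝ)) (fun t =>
      (a₁ * Real.cos (ξ * (t - s) - c) + a₂ * Real.sin (ξ * (t - s) - c)) / (a₁ ^ 2 + a₂ ^ 2)
        * ρ t) s
    simp only [add_sub_cancel_left] at shift
    rw [shift]
    have e : ∀ t, (a₁ * Real.cos (ξ * (t - s) - c) + a₂ * Real.sin (ξ * (t - s) - c))
          / (a₁ ^ 2 + a₂ ^ 2) * ρ t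
        = (a₁ * Real.cos (ξ * s + c) - a₂ * Real.sin (ξ * s + c)) / (a₁ ^ 2 + a₂ ^ 2)
            * (ρ t * Real.cos (ξ * t))
          + (a₁ * Real.sin (ξ * s + c) + a₂ * Real.cos (ξ * s + c)) / (a₁ ^ 2 + a₂ ^ 2)
            * (ρ t * Real.sin (ξ * t)) := by
      intro t
      rw [show ξ * (t - s) - c = ξ * t - (ξ * s + c) by ring, Real.cos_sub, Real.sin_sub]
      ring
    simp_rw [e]
    rw [integral_add (ic.const_mul _) (is.const_mul _), integral_const_mul, integral_const_mul,
      ← ha₁, ← ha₂]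
    field_simp
    ring

/-! ### Superpositions of ridge functions -/

/-- For fixed w the map is a translation in b. This is what makes integrability and moment bounds
for ridge functions independent of z. -/
theorem measurePreserving_shear {d : ℕ} (μ : Measure (Euc d)) [SFinite μ] (z : Euc d) :
    MeasurePreserving (fun p : Euc d × ℝ => (p.1, inner ℝ p.1 z + p.2))
      (μ.prod volume) (μ.prod volume) :=
  (MeasurePreserving.id μ).skew_product (g := fun w b => inner ℝ w z + b)
    (by unfold Function.uncurry; fun_prop)
    (ae_of_all _ fun w => (measurePreserving_add_left volume (inner ℝ w z)).map_eq)

theorem MeasureTheory.MemLp.ridge {d : ℕ} {ρ : ℝ → ℝ} {p : ENNReal} (hρ : MemLp ρ p volume)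
    (μ : Measure (Euc d)) [IsFiniteMeasure μ] (z : Euc d) :
    MemLp (fun q : Euc d × ℝ => ρ (inner ℝ q.1 z + q.2)) p (μ.prod volume) :=
  (hρ.comp_snd μ).comp_measurePreserving (measurePreserving_shear μ z)

/-- A bounded measurable weight with bounded support on the space of inner weights and biases. -/
def IsBoundedWeight {d : ℕ} (G : Euc d × ℝ → ℝ) : Prop :=
  Measurable G ∧ ∃ C R : ℝ, ∀ p, |G p| ≤ C ∧ (G p ≠ 0 → ‖p.1‖ ≤ R ∧ |p.2| ≤ R)

theorem IsBoundedWeight.zero {d : ℕ} : IsBoundedWeight (0 : Euc d × ℝ → ℝ) :=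
  ⟨measurable_zero, 0, 0, fun p => by simp⟩

theorem IsBoundedWeight.add {d : ℕ} {G H : Euc d × ℝ → ℝ} (hG : IsBoundedWeight G)
    (hH : IsBoundedWeight H) : IsBoundedWeight (G + H) := by
  obtain ⟨mG, C, R, h⟩ := hG
  obtain ⟨mH, C', R', h'⟩ := hH
  refine ⟨mG.add mH, C + C', max R R', fun p =>
    ⟨(abs_add_le _ _).trans (add_le_add (h p).1 (h' p).1), fun hp => ?_⟩⟩
  by_cases h0 : G p = 0
  · have : H p ≠ 0 := by simpa [h0] using hp
    exact ⟨((h' p).2 this).1.trans (le_max_right _ _), ((h' p).2 this).2.trans (le_max_right _ _)⟩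
  · exact ⟨((h p).2 h0).1.trans (le_max_left _ _), ((h p).2 h0).2.trans (le_max_left _ _)⟩

theorem IsBoundedWeight.const_smul {d : ℕ} {G : Euc d × ℝ → ℝ} (hG : IsBoundedWeight G) (a : ℝ) :
    IsBoundedWeight (a • G) := by
  obtain ⟨mG, C, R, h⟩ := hG
  refine ⟨mG.const_smul a, |a| * C, R, fun p => ⟨?_, fun hp => (h p).2 ?_⟩⟩
  · rw [Pi.smul_apply, smul_eq_mul, abs_mul]
    exact mul_le_mul_of_nonneg_left (h p).1 (abs_nonneg _)
  · intro h0
    simp [h0] at hp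

/-- The superposition `z ↦ ∫ G(w, b) ρ(⟨w, z⟩ + b) d(w, b)`. -/
noncomputable def ridgeIntegral {d : ℕ} (ρ : ℝ → ℝ) (G : Euc d × ℝ → ℝ) (z : Euc d) : ℝ :=
  ∫ p : Euc d × ℝ, G p * ρ (inner ℝ p.1 z + p.2)

theorem IsBoundedWeight.integrable {d : ℕ} {ρ : ℝ → ℝ} (hρ : Integrable ρ)
    {G : Euc d × ℝ → ℝ} (hG : IsBoundedWeight G) (z : Euc d) :
    Integrable fun p : Euc d × ℝ => G p * ρ (inner ℝ p.1 z + p.2) := by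
  obtain ⟨mG, C, R, h⟩ := hG
  have : IsFiniteMeasure ((volume : Measure (Euc d)).restrict (Metric.closedBall 0 R)) :=
    ⟨by simpa using measure_closedBall_lt_top⟩
  have h1 := (memLp_one_iff_integrable.2 hρ).ridge
    ((volume : Measure (Euc d)).restrict (Metric.closedBall 0 R)) z
  rw [memLp_one_iff_integrable] at h1
  have h2 := h1.bdd_mul (f := G) (c := C) mG.aestronglyMeasurable
    (ae_of_all _ fun p => (h p).1)
  rw [← Measure.restrict_univ (μ := (volume : Measure ℝ)), Measure.prod_restrict] at h2
  refine (integrableOn_iff_integrable_of_support_subset ?_).1 h2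
  intro p hp
  have : G p ≠ 0 := fun h0 => hp (by simp [h0])
  simpa using ((h p).2 this).1

theorem ridgeIntegral_add {d : ℕ} {ρ : ℝ → ℝ} (hρ : Integrable ρ) {G H : Euc d × ℝ → ℝ}
    (hG : IsBoundedWeight G) (hH : IsBoundedWeight H) (z : Euc d) :
    ridgeIntegral ρ (G + H) z = ridgeIntegral ρ G z + ridgeIntegral ρ H z := by
  simp only [ridgeIntegral]
  rw [← integral_add (hG.integrable hρ z) (hH.integrable hρ z)]
  simp [add_mul]

theorem ridgeIntegral_smul {d : ℕ} (ρ : ℝ → ℝ) (a : ℝ) (G : Euc d × ℝ → ℝ) (z : Euc d) :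
    ridgeIntegral ρ (a • G) z = a * ridgeIntegral ρ G z := by
  simp only [ridgeIntegral]
  rw [← integral_const_mul]
  simp [mul_assoc]

/-- `f` is a uniform limit on `K` of superpositions of ridge functions with profile `ρ`. -/
def RidgeApprox {d : ℕ} (ρ : ℝ → ℝ) (K : Set (Euc d)) (f : Euc d → ℝ) : Prop :=
  ∀ ε > 0, ∃ G, IsBoundedWeight G ∧ ∀ z ∈ K, |f z - ridgeIntegral ρ G z| < ε

theorem RidgeApprox.zero {d : ℕ} {ρ : ℝ → ℝ} {K : Set (Euc d)} : RidgeApprox ρ K 0 :=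
  fun ε hε => ⟨0, .zero, fun z _ => by simpa [ridgeIntegral] using hε⟩

theorem RidgeApprox.add {d : ℕ} {ρ : ℝ → ℝ} (hρ : Integrable ρ) {K : Set (Euc d)}
    {f g : Euc d → ℝ} (hf : RidgeApprox ρ K f) (hg : RidgeApprox ρ K g) :
    RidgeApprox ρ K (f + g) := by
  intro ε hε
  obtain ⟨G, hG, h⟩ := hf (ε / 2) (half_pos hε)
  obtain ⟨H, hH, h'⟩ := hg (ε / 2) (half_pos hε)
  refine ⟨G + H, hG.add hH, fun z hz => ?_⟩
  rw [ridgeIntegral_add hρ hG hH, Pi.add_apply, add_sub_add_comm]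
  exact (abs_add_le _ _).trans_lt (by linarith [h z hz, h' z hz])

theorem RidgeApprox.const_smul {d : ℕ} {ρ : ℝ → ℝ} {K : Set (Euc d)}
    {f : Euc d → ℝ} (hf : RidgeApprox ρ K f) (a : ℝ) : RidgeApprox ρ K (a • f) := by
  intro ε hε
  obtain ⟨G, hG, h⟩ := hf (ε / (|a| + 1)) (by positivity)
  refine ⟨a • G, hG.const_smul a, fun z hz => ?_⟩
  rw [ridgeIntegral_smul, Pi.smul_apply, smul_eq_mul, ← mul_sub, abs_mul]
  have := h z hz
  rw [lt_div_iff₀ (by positivity)] at this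
  nlinarith [abs_nonneg (f z - ridgeIntegral ρ G z)]

theorem RidgeApprox.of_forall_near {d : ℕ} {ρ : ℝ → ℝ} {K : Set (Euc d)} {f : Euc d → ℝ}
    (h : ∀ ε > 0, ∃ g, RidgeApprox ρ K g ∧ ∀ z ∈ K, |g z - f z| < ε) : RidgeApprox ρ K f := by
  intro ε hε
  obtain ⟨g, hg, hgf⟩ := h (ε / 2) (half_pos hε)
  obtain ⟨G, hG, h'⟩ := hg (ε / 2) (half_pos hε)
  refine ⟨G, hG, fun z hz => ?_⟩
  have h1 := hgf z hz
  have h2 := h' z hz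
  rw [abs_lt] at *
  constructor <;> linarith

/-! ### Plane waves as limits of superpositions -/

theorem exists_tail_lt {ρ : ℝ → ℝ} (hρ : Integrable ρ) {ε : ℝ} (hε : 0 < ε) :
    ∃ B : ℝ, ∫ t in {t | B < |t|}, |ρ t| < ε := by
  have h := tendsto_setIntegral_of_antitone (μ := volume) (f := fun t => |ρ t|)
    (s := fun n : ℕ => {t : ℝ | (n : ℝ) < |t|})
    (fun n => measurableSet_lt measurable_const (by fun_prop))
    (fun m n hmn t ht => by
      simp only [Set.mem_ofPred_eq] at ht ⊢
      exact lt_of_le_of_lt (Nat.cast_le.2 hmn) ht) ⟨0, hρ.abs.integrableOn⟩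
  have h0 : ⋂ n : ℕ, {t : ℝ | (n : ℝ) < |t|} = ∅ := by
    ext t
    obtain ⟨n, hn⟩ := exists_nat_ge |t|
    simp only [Set.mem_iInter, Set.mem_ofPred_eq, Set.mem_empty_iff_false, iff_false, not_forall,
      not_lt]
    exact ⟨n, hn⟩
  rw [h0, setIntegral_empty] at h
  obtain ⟨n, hn⟩ := (h.eventually (gt_mem_nhds hε)).exists
  exact ⟨n, hn⟩

/-- If |b| > B + D and |s| ≤ D, then |s + b| > B, so one tail of ρ controls all these translates at
once. -/
theorem abs_setIntegral_translate_le {ρ γ : ℝ → ℝ} (hρ : Integrable ρ) {C B D s : ℝ}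
    (hC : ∀ b, |γ b| ≤ C) (hs : |s| ≤ D) :
    |∫ b in {b | B + D < |b|}, γ b * ρ (s + b)| ≤ C * ∫ t in {t | B < |t|}, |ρ t| := by
  have hC0 : 0 ≤ C := (abs_nonneg _).trans (hC 0)
  have hm : ∀ r : ℝ, MeasurableSet {b : ℝ | r < |b|} := fun r =>
    measurableSet_lt measurable_const (by fun_prop)
  have h1 : ∫ b in {b | B + D < |b|}, |ρ (s + b)| ≤ ∫ t in {t | B < |t|}, |ρ t| := by
    rw [← integral_indicator (hm _), ← integral_indicator (hm _),
      ← integral_add_left_eq_self (fun t => Set.indicator {t | B < |t|} (fun t => |ρ t|) t) s]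
    refine integral_mono ((hρ.comp_add_left s).abs.indicator (hm _))
      ((hρ.abs.indicator (hm B)).comp_add_left s) fun b => ?_
    simp only [Set.indicator_apply, Set.mem_ofPred_eq]
    split_ifs with h2 h3
    · exact le_rfl
    · have h4 : |b| ≤ |s + b| + |s| := by simpa using abs_sub (s + b) s
      exact absurd (by linarith) h3
    · positivity
    · exact le_rfl
  refine (abs_integral_le_integral_abs).trans ?_
  refine le_trans ?_ (mul_le_mul_of_nonneg_left h1 hC0)
  rw [← integral_const_mul]
  refine integral_mono_of_nonneg (ae_of_all _ fun b => abs_nonneg _)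
    ((hρ.comp_add_left s).abs.integrableOn.const_mul C) (ae_of_all _ fun b => ?_)
  simp only [abs_mul]
  exact mul_le_mul_of_nonneg_right (hC b) (abs_nonneg _)

/-- The exact representation sits on the single direction w₀, a null set in general, and uses all b.
Averaging over a ball around w₀ and cutting off large b makes it an admissible weight; each change
costs at most ε/4. -/
theorem ridgeApprox_cos {d : ℕ} {ρ : ℝ → ℝ} (hρ : Integrable ρ) {K : Set (Euc d)}
    (hK : Bornology.IsBounded K) {ξ c : ℝ} (hξ : ξ ≠ 0) {γ : ℝ → ℝ} {C : ℝ} (hγ : Continuous γ)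
    (hC : ∀ b, |γ b| ≤ C) (hγρ : ∀ s, ∫ b, γ b * ρ (s + b) = Real.cos (ξ * s + c))
    (w₀ : Euc d) : RidgeApprox ρ K (fun z => Real.cos (ξ * inner ℝ w₀ z + c)) := by
  classical
  intro ε hε
  obtain ⟨M, hM0, hM⟩ : ∃ M > 0, ∀ z ∈ K, ‖z‖ ≤ M := hK.exists_pos_norm_le
  have hC0 : 0 ≤ C := (abs_nonneg _).trans (hC 0)
  have hξ0 : 0 < |ξ| := abs_pos.2 hξ
  obtain ⟨B, hB⟩ := exists_tail_lt hρ (ε := ε / (4 * (C + 1))) (by positivity)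
  -- The radius makes the phase error |ξ| r M equal to ε/4. Below, D bounds |⟨w, z⟩| for w in the
  -- ball and z in K.
  set r : ℝ := ε / (4 * (|ξ| * M)) with hr
  have hr0 : 0 < r := by positivity
  set D : ℝ := (‖w₀‖ + r) * M
  set A : Set (Euc d) := Metric.closedBall w₀ r
  set I : Set ℝ := {b | |b| ≤ B + D}
  have hA : MeasurableSet A := measurableSet_closedBall
  have hI : MeasurableSet I := measurableSet_le (by fun_prop) measurable_const
  have hV0 : 0 < (volume : Measure (Euc d)).real A :=
    ENNReal.toReal_pos (Metric.measure_closedBall_pos _ _ hr0).ne' measure_closedBall_lt_top.ne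
  set V := (volume : Measure (Euc d)).real A
  set G : Euc d × ℝ → ℝ := (A ×ˢ I).indicator fun p => V⁻¹ * γ p.2 with hG
  have hGw : IsBoundedWeight G := by
    refine ⟨(Measurable.const_mul (hγ.measurable.comp measurable_snd) _).indicator
      (hA.prod hI), V⁻¹ * C, max (‖w₀‖ + r) (B + D), fun p => ⟨?_, fun hp => ?_⟩⟩
    · rw [hG, Set.indicator_apply]
      split_ifs
      · rw [abs_mul, abs_of_pos (inv_pos.2 hV0)]
        exact mul_le_mul_of_nonneg_left (hC _) (inv_pos.2 hV0).le
      · rw [abs_zero]; positivity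
    · have hp' := Set.mem_of_indicator_ne_zero hp
      rw [Set.mem_prod] at hp'
      have h1 : dist p.1 w₀ ≤ r := hp'.1
      rw [dist_eq_norm] at h1
      have h2 : |p.2| ≤ B + D := by simpa [I] using hp'.2
      have h3 : ‖p.1‖ ≤ ‖p.1 - w₀‖ + ‖w₀‖ := by simpa using norm_add_le (p.1 - w₀) w₀
      exact ⟨le_trans (by linarith) (le_max_left _ _), h2.trans (le_max_right _ _)⟩
  refine ⟨G, hGw, fun z hz => ?_⟩
  set H : Euc d → ℝ := fun w => ∫ b in I, γ b * ρ (inner ℝ w z + b) with hH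
  have hint := hGw.integrable hρ z
  have e1 : ridgeIntegral ρ G z = ∫ w in A, V⁻¹ * H w := by
    rw [ridgeIntegral, Measure.volume_eq_prod, integral_prod _ hint, ← integral_indicator hA]
    congr 1 with w
    rw [Set.indicator_apply]
    split_ifs with hw
    · rw [hH, ← integral_const_mul, ← integral_indicator hI]
      congr 1 with b
      simp only [hG, Set.indicator_apply, Set.mem_prod, hw, true_and]
      split_ifs <;> ring
    · simp [hG, hw]
  have iH : IntegrableOn (fun w => V⁻¹ * H w) A := by
    have h1 := hint.integral_prod_left
    refine h1.integrableOn.congr_fun (fun w hw => ?_) hA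
    simp only
    rw [hH, ← integral_const_mul, ← integral_indicator hI]
    congr 1 with b
    simp only [hG, Set.indicator_apply, Set.mem_prod, hw, true_and]
    split_ifs <;> ring
  have hpt : ∀ w ∈ A, |H w - Real.cos (ξ * inner ℝ w₀ z + c)| ≤ ε / 2 := by
    intro w hw
    have hw' : ‖w - w₀‖ ≤ r := by rw [← dist_eq_norm]; exact hw
    have hwn : ‖w‖ ≤ ‖w₀‖ + r := by
      have : ‖w‖ ≤ ‖w - w₀‖ + ‖w₀‖ := by simpa using norm_add_le (w - w₀) w₀
      linarith
    have hs : |inner ℝ w z| ≤ D := (abs_real_inner_le_norm w z).trans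
      (mul_le_mul hwn (hM z hz) (norm_nonneg _) (by positivity))
    have iw : Integrable fun b => γ b * ρ (inner ℝ w z + b) :=
      (hρ.comp_add_left _).bdd_mul (c := C) hγ.aestronglyMeasurable (ae_of_all _ hC)
    have hIc : Iᶜ = {b | B + D < |b|} := by ext b; simp [I]
    have e2 : H w = Real.cos (ξ * inner ℝ w z + c)
        - ∫ b in {b | B + D < |b|}, γ b * ρ (inner ℝ w z + b) := by
      rw [← hγρ, ← integral_add_compl hI iw, hIc, add_sub_cancel_right]
    have h1 := abs_setIntegral_translate_le hρ (B := B) hC hs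
    have h2 : C * ∫ t in {t | B < |t|}, |ρ t| ≤ ε / 4 := by
      have h3 : (C + 1) * (ε / (4 * (C + 1))) = ε / 4 := by field_simp
      rw [← h3]
      have : 0 ≤ ∫ t in {t | B < |t|}, |ρ t| := integral_nonneg fun t => abs_nonneg _
      exact mul_le_mul (by linarith) hB.le this (by linarith)
    have h4 : |Real.cos (ξ * inner ℝ w z + c) - Real.cos (ξ * inner ℝ w₀ z + c)| ≤ ε / 4 := by
      refine (Real.abs_cos_sub_cos_le _ _).trans ?_
      rw [show ξ * inner ℝ w z + c - (ξ * inner ℝ w₀ z + c) = ξ * inner ℝ (w - w₀) z by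
        rw [inner_sub_left]; ring, abs_mul]
      have h5 : |inner ℝ (w - w₀) z| ≤ r * M := (abs_real_inner_le_norm _ z).trans
        (mul_le_mul hw' (hM z hz) (norm_nonneg _) hr0.le)
      calc |ξ| * |inner ℝ (w - w₀) z| ≤ |ξ| * (r * M) := by gcongr
        _ = ε / 4 := by rw [hr]; field_simp
    rw [e2]
    rw [abs_le] at *
    constructor <;> linarith
  have e3 : ridgeIntegral ρ G z - Real.cos (ξ * inner ℝ w₀ z + c)
      = ∫ w in A, (V⁻¹ * H w - V⁻¹ * Real.cos (ξ * inner ℝ w₀ z + c)) := by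
    rw [integral_sub iH (integrableOn_const measure_closedBall_lt_top.ne), ← e1,
      setIntegral_const, smul_eq_mul, mul_inv_cancel_left₀ hV0.ne']
  rw [abs_sub_comm, e3]
  have := norm_setIntegral_le_of_norm_le_const (μ := (volume : Measure (Euc d))) (s := A)
    (C := V⁻¹ * (ε / 2)) measure_closedBall_lt_top
    (f := fun w => V⁻¹ * H w - V⁻¹ * Real.cos (ξ * inner ℝ w₀ z + c)) (fun w hw => by
      rw [← mul_sub, norm_mul, Real.norm_of_nonneg (inv_pos.2 hV0).le]
      exact mul_le_mul_of_nonneg_left (hpt w hw) (inv_pos.2 hV0).le)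
  refine lt_of_le_of_lt this ?_
  change V⁻¹ * (ε / 2) * V < ε
  have : V⁻¹ * (ε / 2) * V = ε / 2 := by field_simp
  linarith

/-! ### Density by Stone–Weierstrass -/

/-- The plane waves `z ↦ cos(⟨w, z⟩ + c)`. -/
noncomputable def planeWave {d : ℕ} (w : Euc d) (c : ℝ) : C(Euc d, ℝ) :=
  ⟨fun z => Real.cos (inner ℝ w z + c), by fun_prop⟩

theorem planeWave_mul {d : ℕ} (w w' : Euc d) (c c' : ℝ) :
    planeWave w c * planeWave w' c' =
      (1 / 2 : ℝ) • (planeWave (w + w') (c + c') + planeWave (w - w') (c - c')) := by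
  ext z
  simp only [planeWave, ContinuousMap.mul_apply, ContinuousMap.coe_mk, ContinuousMap.smul_apply,
    ContinuousMap.add_apply, inner_add_left, inner_sub_left, smul_eq_mul]
  rw [show inner ℝ w z + inner ℝ w' z + (c + c') = (inner ℝ w z + c) + (inner ℝ w' z + c') by ring,
    show inner ℝ w z - inner ℝ w' z + (c - c') = (inner ℝ w z + c) - (inner ℝ w' z + c') by ring,
    Real.cos_add (_ + c), Real.cos_sub (_ + c)]
  ring

/-- The algebra of trigonometric polynomials. -/
noncomputable def trigAlgebra (d : ℕ) : Subalgebra ℝ C(Euc d, ℝ) :=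
  (Submodule.span ℝ {f | ∃ w c, f = planeWave w c}).toSubalgebra
    (Submodule.subset_span ⟨0, 0, by ext; simp [planeWave]⟩)
    (fun f g hf hg => by
      induction hf, hg using Submodule.span_induction₂ with
      | mem_mem f g hf hg =>
        obtain ⟨w, c, rfl⟩ := hf
        obtain ⟨w', c', rfl⟩ := hg
        rw [planeWave_mul]
        exact Submodule.smul_mem _ _ (Submodule.add_mem _ (Submodule.subset_span ⟨_, _, rfl⟩)
          (Submodule.subset_span ⟨_, _, rfl⟩))
      | zero_left => simp
      | zero_right => simp
      | add_left _ _ _ _ _ _ h1 h2 => rw [add_mul]; exact Submodule.add_mem _ h1 h2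
      | add_right _ _ _ _ _ _ h1 h2 => rw [mul_add]; exact Submodule.add_mem _ h1 h2
      | smul_left a _ _ _ _ h => rw [smul_mul_assoc]; exact Submodule.smul_mem _ _ h
      | smul_right a _ _ _ _ h => rw [mul_smul_comm]; exact Submodule.smul_mem _ _ h)

theorem trigAlgebra_separatesPoints (d : ℕ) : (trigAlgebra d).SeparatesPoints := by
  intro x y hxy
  have hn : 0 < ‖x - y‖ := norm_pos_iff.2 (sub_ne_zero.2 hxy)
  -- The scaling makes ⟨w, x − y⟩ = 1, so with phase −⟨w, y⟩ the wave takes the values cos 1 at x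
  -- and cos 0 at y.
  set w : Euc d := (1 / ‖x - y‖ ^ 2) • (x - y) with hw
  have h1 : inner ℝ w x = 1 + inner ℝ w y := by
    have : inner ℝ w (x - y) = 1 := by
      rw [hw, real_inner_smul_left, real_inner_self_eq_norm_sq]
      field_simp
    rw [inner_sub_right] at this
    linarith
  refine ⟨planeWave w (-inner ℝ w y), ⟨_, Submodule.subset_span ⟨w, _, rfl⟩, rfl⟩, ?_⟩
  have := Real.cos_one_le
  simp only [planeWave, ContinuousMap.coe_mk, h1, add_neg_cancel_right, add_neg_cancel,
    Real.cos_zero]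
  linarith

/-- Superpositions of ridge functions with a nonzero integrable profile are dense. -/
theorem ridgeApprox_of_continuous {d : ℕ} {ρ : ℝ → ℝ} (hρ : Integrable ρ)
    (hρ0 : ¬ ρ =ᵐ[volume] 0) {K : Set (Euc d)} (hK : IsCompact K) {f : Euc d → ℝ}
    (hf : Continuous f) : RidgeApprox ρ K f := by
  obtain ⟨ξ, hξ, hw⟩ := exists_weight_cos hρ hρ0
  have hcos : ∀ (w : Euc d) c, RidgeApprox ρ K (planeWave w c) := by
    intro w c
    obtain ⟨γ, C, h1, h2, h3⟩ := hw c
    -- The weight γ produces frequency ξ, so the direction is rescaled by ξ⁻¹ to compensate.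
    have := ridgeApprox_cos hρ hK.isBounded hξ h1 h2 h3 (ξ⁻¹ • w)
    convert this using 2 with z
    simp only [planeWave, ContinuousMap.coe_mk]
    rw [real_inner_smul_left, mul_inv_cancel_left₀ hξ]
  refine .of_forall_near fun ε hε => ?_
  obtain ⟨g, hg, hgf⟩ :=
    ContinuousMap.exists_mem_subalgebra_near_continuous_of_isCompact_of_separatesPoints
      (trigAlgebra_separatesPoints d) ⟨f, hf⟩ hK hε
  refine ⟨g, ?_, hgf⟩
  clear hgf
  replace hg : g ∈ Submodule.span ℝ {f | ∃ (w : Euc d) (c : ℝ), f = planeWave w c} := hg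
  induction hg using Submodule.span_induction with
  | mem f hf => obtain ⟨w, c, rfl⟩ := hf; exact hcos w c
  | zero => exact .zero
  | add _ _ _ _ h1 h2 => exact h1.add hρ h2
  | smul a _ _ h => exact h.const_smul a

/-! ### The law of inner weights and biases -/

/-- The joint law of the inner weight and the bias of one node. -/
noncomputable def innerLaw {d : ℕ} (T : Set (Euc d)) (α Ω : ℝ) : Measure (Euc d × ℝ) :=
  (sampleLaw T α Ω).map fun t => (t.1, bias α t.1 t.2.1 t.2.2)

theorem measurable_bias {d : ℕ} (α : ℝ) :
    Measurable fun t : Euc d × Euc d × ℝ => (t.1, bias α t.1 t.2.1 t.2.2) := by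
  unfold bias
  fun_prop

theorem cube_eq_preimage (d : ℕ) (r : ℝ) :
    cube d r = (WithLp.ofLp : Euc d → Fin d → ℝ) ⁻¹' (Set.Icc (fun _ => -r) fun _ => r) := by
  ext w
  simp [cube, Pi.le_def, forall_and]

theorem measurableSet_cube (d : ℕ) (r : ℝ) : MeasurableSet (cube d r) := by
  rw [cube_eq_preimage]
  exact (PiLp.volume_preserving_ofLp (Fin d)).measurable measurableSet_Icc

theorem volume_cube (d : ℕ) (r : ℝ) :
    (volume : Measure (Euc d)) (cube d r) = ENNReal.ofReal (2 * r) ^ d := by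
  rw [cube_eq_preimage, (PiLp.volume_preserving_ofLp (Fin d)).measure_preimage
    measurableSet_Icc.nullMeasurableSet, Real.volume_Icc_pi]
  simp [two_mul]

/-- Half the length of the phase interval. -/
noncomputable def phaseRadius {d : ℕ} (S : Set (Euc d)) (Ω : ℝ) : ℝ :=
  Real.pi / 2 * (2 * (phaseIndex S Ω : ℝ) + 1)

theorem phaseInterval_eq {d : ℕ} (S : Set (Euc d)) (Ω : ℝ) :
    phaseInterval S Ω = Set.Icc (-phaseRadius S Ω) (phaseRadius S Ω) := rfl

theorem rad_nonneg {d : ℕ} (S : Set (Euc d)) : 0 ≤ rad S :=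
  Real.sSup_nonneg (by rintro _ ⟨x, -, rfl⟩; exact norm_nonneg x)

theorem norm_le_rad {d : ℕ} {S : Set (Euc d)} (hS : Bornology.IsBounded S) {x : Euc d}
    (hx : x ∈ S) : ‖x‖ ≤ rad S := by
  obtain ⟨C, hC⟩ := hS.exists_norm_le
  exact le_csSup ⟨C, by rintro _ ⟨y, hy, rfl⟩; exact hC y hy⟩ ⟨x, hx, rfl⟩

/-- The −1/2 inside the ceiling cancels the +1 in 2L + 1. The factor 2 leaves half of the phase
interval for ⟨w, y⟩ and half for the bias. -/
theorem two_mul_rad_le_phaseRadius {d : ℕ} (S : Set (Euc d)) (Ω : ℝ) :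
    2 * (d * rad S * Ω) ≤ phaseRadius S Ω := by
  have h := Int.le_ceil (2 * (d : ℝ) / Real.pi * rad S * Ω - 1 / 2)
  change _ ≤ ((phaseIndex S Ω : ℤ) : ℝ) at h
  have hpi := Real.pi_pos
  calc 2 * (d * rad S * Ω)
      _ = Real.pi / 2 * (2 * (2 * (d : ℝ) / Real.pi * rad S * Ω - 1 / 2) + 1) := by
        field_simp; ring
      _ ≤ _ := by unfold phaseRadius; gcongr

theorem pi_div_two_le_phaseRadius {d : ℕ} (S : Set (Euc d)) {Ω : ℝ} (hΩ : 0 ≤ Ω) :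
    Real.pi / 2 ≤ phaseRadius S Ω := by
  have hpi := Real.pi_pos
  have h0 : 0 ≤ 2 * (d : ℝ) / Real.pi * rad S * Ω := by
    have := rad_nonneg S
    positivity
  have h : 0 ≤ phaseIndex S Ω := by
    -- The argument of the ceiling is at least −1/2, hence above −1.
    have : -1 < phaseIndex S Ω := by
      rw [phaseIndex, Int.lt_ceil]
      push_cast
      linarith
    omega
  have h' : (0 : ℝ) ≤ phaseIndex S Ω := by exact_mod_cast h
  unfold phaseRadius
  nlinarith

theorem abs_inner_le_of_mem_cube {d : ℕ} {r : ℝ} {w : Euc d} (hw : w ∈ cube d r) (y : Euc d) :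
    |inner ℝ w y| ≤ r * (d * ‖y‖) := by
  rw [PiLp.inner_apply]
  have h1 : ∀ i, |w i| ≤ r := fun i => abs_le.2 (hw i)
  calc |∑ i, inner ℝ (w i) (y i)| ≤ ∑ i, |inner ℝ (w i) (y i)| := Finset.abs_sum_le_sum_abs _ _
    _ ≤ ∑ _i : Fin d, r * ‖y‖ := by
        refine Finset.sum_le_sum fun i _ => ?_
        have h2 : |y i| ≤ ‖y‖ := by simpa using PiLp.norm_apply_le y i
        have h3 : inner ℝ (w i) (y i) = y i * w i := by simp
        rw [h3, abs_mul, mul_comm]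
        exact mul_le_mul (h1 i) h2 (abs_nonneg _) ((abs_nonneg _).trans (h1 i))
    _ = r * (d * ‖y‖) := by simp; ring

theorem lintegral_comp_neg_sub_mul {α : ℝ} (hα : 0 < α) (c : ℝ) {F : ℝ → ENNReal}
    (hF : Measurable F) :
    ∫⁻ u, F (-c - α * u) = ENNReal.ofReal α⁻¹ * ∫⁻ b, F b := by
  have h1 := lintegral_map (μ := (volume : Measure ℝ)) (f := fun b => F (-c - b)) (g := (α * ·))
    (by fun_prop) (by fun_prop)
  rw [← h1, Real.map_volume_mul_left hα.ne', lintegral_smul_measure, smul_eq_mul,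
    abs_of_pos (inv_pos.2 hα), lintegral_sub_left_eq_self]

/-- The density of the inner law on the region where the bias is unaffected by truncation. -/
noncomputable def innerDensity {d : ℕ} (T : Set (Euc d)) (α Ω : ℝ) : ENNReal :=
  (volume (cube d (α * Ω)))⁻¹ * ((volume (phaseInterval T Ω))⁻¹ * ENNReal.ofReal α⁻¹)

theorem lintegral_innerLaw {d : ℕ} {T : Set (Euc d)} (α Ω : ℝ)
    {F : Euc d × ℝ → ENNReal} (hF : Measurable F) :
    ∫⁻ p, F p ∂(innerLaw T α Ω) = (volume (cube d (α * Ω)))⁻¹ * ∫⁻ w in cube d (α * Ω),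
      (volume T)⁻¹ * ∫⁻ y in T, (volume (phaseInterval T Ω))⁻¹ *
        ∫⁻ u in phaseInterval T Ω, F (w, -(inner ℝ w y) - α * u) := by
  have hFb : Measurable fun t : Euc d × Euc d × ℝ => F (t.1, bias α t.1 t.2.1 t.2.2) :=
    hF.comp (measurable_bias α)
  have hu : SFinite (unif (phaseInterval T Ω)) := by
    unfold unif ProbabilityTheory.cond; infer_instance
  have hT : SFinite (unif T) := by unfold unif ProbabilityTheory.cond; infer_instance
  rw [innerLaw, lintegral_map hF (measurable_bias α), sampleLaw, lintegral_prod _ hFb.aemeasurable]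
  have e : ∀ w : Euc d, ∫⁻ x, F (w, bias α w x.1 x.2) ∂((unif T).prod (unif (phaseInterval T Ω)))
      = (volume T)⁻¹ * ∫⁻ y in T, (volume (phaseInterval T Ω))⁻¹ *
        ∫⁻ u in phaseInterval T Ω, F (w, -(inner ℝ w y) - α * u) := by
    intro w
    have hw : Measurable fun x : Euc d × ℝ => F (w, bias α w x.1 x.2) :=
      hFb.comp measurable_prodMk_left
    rw [lintegral_prod _ hw.aemeasurable]
    simp only [unif, ProbabilityTheory.cond, lintegral_smul_measure, smul_eq_mul, bias]
  simp only [e]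
  simp only [unif, ProbabilityTheory.cond, lintegral_smul_measure, smul_eq_mul]

theorem lintegral_innerDensity_smul {d : ℕ} (T : Set (Euc d)) (α Ω : ℝ)
    {F : Euc d × ℝ → ENNReal} (hF : Measurable F) :
    ∫⁻ p, F p ∂(innerDensity T α Ω • (volume.restrict (cube d (α * Ω))).prod volume) =
    (volume (cube d (α * Ω)))⁻¹ * ∫⁻ w in cube d (α * Ω),
      (volume (phaseInterval T Ω))⁻¹ * (ENNReal.ofReal α⁻¹ * ∫⁻ b, F (w, b)) := by
  rw [lintegral_smul_measure, smul_eq_mul, lintegral_prod _ hF.aemeasurable, innerDensity]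
  have hm : Measurable fun w => ∫⁻ b, F (w, b) := hF.lintegral_prod_right'
  rw [lintegral_const_mul _ (by fun_prop), lintegral_const_mul _ hm]
  ring

/-- Letting u range over all of ℝ only enlarges the integral. After that it no longer depends on y,
and averaging over T contributes a factor at most 1. -/
theorem innerLaw_le {d : ℕ} {T : Set (Euc d)} {α Ω : ℝ} (hα : 0 < α) :
    innerLaw T α Ω ≤ innerDensity T α Ω • (volume.restrict (cube d (α * Ω))).prod volume := by
  refine Measure.le_iff.2 fun E hE => ?_
  have hF : Measurable (E.indicator (1 : Euc d × ℝ → ENNReal)) := measurable_one.indicator hE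
  rw [← lintegral_indicator_one hE, ← lintegral_indicator_one hE, lintegral_innerLaw α Ω hF,
    lintegral_innerDensity_smul T α Ω hF]
  refine mul_le_mul' le_rfl (lintegral_mono fun w => ?_)
  calc _ ≤ (volume T)⁻¹ * ∫⁻ y in T, (volume (phaseInterval T Ω))⁻¹ *
        (ENNReal.ofReal α⁻¹ * ∫⁻ b, E.indicator 1 (w, b)) := by
        refine mul_le_mul' le_rfl (lintegral_mono fun y => mul_le_mul' le_rfl ?_)
        refine (setLIntegral_le_lintegral _ _).trans_eq ?_
        exact lintegral_comp_neg_sub_mul hα (inner ℝ w y) (hF.comp measurable_prodMk_left)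
    _ ≤ _ := by
        rw [setLIntegral_const, mul_comm _ (volume T), ← mul_assoc]
        exact mul_le_of_le_one_left (zero_le) (ENNReal.inv_mul_le_one _)

/-- Given w in the cube, y in T and b in this range, the phase solving b = −⟨w, y⟩ − αu lies in the
phase interval automatically, since |⟨w, y⟩| and |b| are each at most half of α times its radius.
The truncation is thus invisible, and averaging over y has no effect. -/
theorem innerLaw_restrict_eq {d : ℕ} {T : Set (Euc d)} (hT : IsOpen T)
    (hTb : Bornology.IsBounded T) (hTn : T.Nonempty) {α Ω : ℝ} (hα : 0 < α) (hΩ : 0 < Ω) :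
    (innerLaw T α Ω).restrict {p | |p.2| ≤ α * (phaseRadius T Ω / 2)} =
      (innerDensity T α Ω • (volume.restrict (cube d (α * Ω))).prod volume).restrict
        {p | |p.2| ≤ α * (phaseRadius T Ω / 2)} := by
  classical
  set A : Set (Euc d × ℝ) := {p | |p.2| ≤ α * (phaseRadius T Ω / 2)}
  have hA : MeasurableSet A := measurableSet_le (by fun_prop) measurable_const
  refine Measure.ext fun E hE => ?_
  rw [Measure.restrict_apply hE, Measure.restrict_apply hE]
  have hEA : MeasurableSet (E ∩ A) := hE.inter hA
  have hF : Measurable ((E ∩ A).indicator (1 : Euc d × ℝ → ENNReal)) := measurable_one.indicator hEA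
  rw [← lintegral_indicator_one hEA, ← lintegral_indicator_one hEA, lintegral_innerLaw α Ω hF,
    lintegral_innerDensity_smul T α Ω hF]
  congr 1
  refine setLIntegral_congr_fun (measurableSet_cube d _) fun w hw => ?_
  have h1 : ∀ y ∈ T, (volume (phaseInterval T Ω))⁻¹ * ∫⁻ u in phaseInterval T Ω,
      (E ∩ A).indicator 1 (w, -(inner ℝ w y) - α * u) = (volume (phaseInterval T Ω))⁻¹ *
        (ENNReal.ofReal α⁻¹ * ∫⁻ b, (E ∩ A).indicator 1 (w, b)) := by
    intro y hy
    congr 1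
    rw [← lintegral_indicator (show MeasurableSet (phaseInterval T Ω) from measurableSet_Icc),
       ← lintegral_comp_neg_sub_mul hα (inner ℝ w y)
      (F := fun b => (E ∩ A).indicator 1 (w, b)) (hF.comp measurable_prodMk_left)]
    congr 1 with u
    rw [Set.indicator_apply, ite_eq_left_iff]
    intro hu
    symm
    rw [Set.indicator_of_notMem]
    intro hmem
    have hb : |-(inner ℝ w y) - α * u| ≤ α * (phaseRadius T Ω / 2) := hmem.2
    refine hu ?_
    have h2 := abs_inner_le_of_mem_cube hw y
    have h3 : α * Ω * (d * ‖y‖) ≤ α * (phaseRadius T Ω / 2) := by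
      rw [mul_assoc]
      have h4 := two_mul_rad_le_phaseRadius T Ω
      have h5 : (d : ℝ) * ‖y‖ ≤ d * rad T := by gcongr; exact norm_le_rad hTb hy
      have h6 : Ω * (d * ‖y‖) ≤ Ω * (d * rad T) := by gcongr
      gcongr
      linarith
    have h4 : |α * u| ≤ α * phaseRadius T Ω := by
      have h5 := abs_sub (-(inner ℝ w y) - α * u) (-inner ℝ w y)
      rw [show -(inner ℝ w y) - α * u - -inner ℝ w y = -(α * u) by ring, abs_neg, abs_neg] at h5
      linarith
    rw [abs_mul, abs_of_pos hα] at h4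
    exact abs_le.1 (le_of_mul_le_mul_left h4 hα)
  rw [setLIntegral_congr_fun hT.measurableSet h1, setLIntegral_const, mul_comm _ (volume T),
    ← mul_assoc, ENNReal.inv_mul_cancel (hT.measure_pos volume hTn).ne' hTb.measure_lt_top.ne,
    one_mul]

theorem innerDensity_ne_top {d : ℕ} {T : Set (Euc d)} {α Ω : ℝ} (hα : 0 < α) (hΩ : 0 < Ω) :
    innerDensity T α Ω ≠ ⊤ := by
  have hR : 0 < phaseRadius T Ω :=
    lt_of_lt_of_le (by positivity) (pi_div_two_le_phaseRadius T hΩ.le)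
  rw [innerDensity, volume_cube, phaseInterval_eq, Real.volume_Icc]
  refine ENNReal.mul_ne_top (ENNReal.inv_ne_top.2 (pow_ne_zero _ ?_))
    (ENNReal.mul_ne_top (ENNReal.inv_ne_top.2 ?_) ENNReal.ofReal_ne_top)
  · rw [Ne, ENNReal.ofReal_eq_zero, not_le]; positivity
  · rw [Ne, ENNReal.ofReal_eq_zero, not_le]; linarith

theorem innerDensity_ne_zero {d : ℕ} {T : Set (Euc d)} {α Ω : ℝ} (hα : 0 < α) :
    innerDensity T α Ω ≠ 0 := by
  rw [innerDensity, volume_cube, phaseInterval_eq, Real.volume_Icc]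
  refine mul_ne_zero (ENNReal.inv_ne_zero.2 (ENNReal.pow_ne_top ENNReal.ofReal_ne_top))
    (mul_ne_zero (ENNReal.inv_ne_zero.2 ENNReal.ofReal_ne_top) ?_)
  rw [Ne, ENNReal.ofReal_eq_zero, not_le]
  positivity

/-- Where the density is constant, an expectation is a multiple of a Lebesgue integral; this is how
a ridge superposition becomes the mean of a random node. -/
theorem integral_innerLaw {d : ℕ} {T : Set (Euc d)} (hT : IsOpen T)
    (hTb : Bornology.IsBounded T) (hTn : T.Nonempty) {α Ω : ℝ} (hα : 0 < α) (hΩ : 0 < Ω)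
    {F : Euc d × ℝ → ℝ}
    (hF : ∀ p, F p ≠ 0 → p.1 ∈ cube d (α * Ω) ∧ |p.2| ≤ α * (phaseRadius T Ω / 2)) :
    ∫ p, F p ∂(innerLaw T α Ω) = (innerDensity T α Ω).toReal * ∫ p, F p := by
  set A : Set (Euc d × ℝ) := {p | |p.2| ≤ α * (phaseRadius T Ω / 2)} with hA
  have h0 : ∀ p, p ∉ A → F p = 0 := fun p hp => by
    by_contra h
    exact hp (hF p h).2
  have h1 : ∀ p, p ∉ cube d (α * Ω) ×ˢ (Set.univ : Set ℝ) → F p = 0 := fun p hp => by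
    by_contra h
    exact hp ⟨(hF p h).1, trivial⟩
  rw [← setIntegral_eq_integral_of_forall_compl_eq_zero h0,
    innerLaw_restrict_eq hT hTb hTn hα hΩ, setIntegral_eq_integral_of_forall_compl_eq_zero h0,
    integral_smul_measure, smul_eq_mul, ← Measure.restrict_univ (μ := (volume : Measure ℝ)),
    Measure.prod_restrict, setIntegral_eq_integral_of_forall_compl_eq_zero h1,
    Measure.volume_eq_prod]

/-- The law of inner weights and biases is dominated by a product measure. -/
def IsDominatedLaw {d : ℕ} (Q : Measure (Euc d × ℝ)) : Prop :=
  ∃ (c : ENNReal) (μ : Measure (Euc d)), c ≠ ⊤ ∧ IsFiniteMeasure μ ∧ Q ≤ c • μ.prod volume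

theorem isDominatedLaw_innerLaw {d : ℕ} (T : Set (Euc d)) {α Ω : ℝ} (hα : 0 < α) (hΩ : 0 < Ω) :
    IsDominatedLaw (innerLaw T α Ω) := by
  refine ⟨_, _, innerDensity_ne_top hα hΩ, ⟨?_⟩, innerLaw_le hα⟩
  rw [Measure.restrict_apply_univ, volume_cube]
  exact ENNReal.pow_lt_top ENNReal.ofReal_lt_top

/-- A continuous function is uniformly close to the mean of a randomly drawn weighted node. -/
theorem exists_outer_weight {d : ℕ} {ρ : ℝ → ℝ} (hρ : Integrable ρ) (hρ0 : ¬ ρ =ᵐ[volume] 0)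
    {T : Set (Euc d)} (hT : IsOpen T) (hTb : Bornology.IsBounded T) {f : Euc d → ℝ}
    (hf : Continuous f) {δ : ℝ} (hδ : 0 < δ) :
    ∃ α : ℝ, 0 < α ∧ ∃ (g : Euc d × ℝ → ℝ) (C : ℝ), Measurable g ∧ (∀ p, |g p| ≤ C) ∧
      ∀ z ∈ T, |f z - ∫ p, g p * ρ (inner ℝ p.1 z + p.2) ∂(innerLaw T α 1)| < δ := by
  obtain ⟨G, ⟨mG, C, R, hG⟩, happ⟩ :=
    ridgeApprox_of_continuous hρ hρ0 hTb.isCompact_closure hf δ hδ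
  -- With Ω = 1, α ≥ 2R puts the ball of radius R inside the cube. It also gives R ≤ α ·
  -- `phaseRadius T 1` / 2, because the phase radius is at least π/2 ≥ 1.
  have hα : 0 < max 1 (2 * R) := lt_max_of_lt_left one_pos
  set α := max 1 (2 * R)
  set c := (innerDensity T α 1).toReal with hc
  have hc0 : 0 < c := ENNReal.toReal_pos (innerDensity_ne_zero hα) (innerDensity_ne_top hα one_pos)
  refine ⟨α, hα, fun p => c⁻¹ * G p, c⁻¹ * C, mG.const_mul _, fun p => ?_, fun z hz => ?_⟩
  · rw [abs_mul, abs_of_pos (inv_pos.2 hc0)]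
    exact mul_le_mul_of_nonneg_left (hG p).1 (inv_pos.2 hc0).le
  · have h1 := integral_innerLaw hT hTb ⟨z, hz⟩ hα one_pos
      (F := fun p => c⁻¹ * G p * ρ (inner ℝ p.1 z + p.2)) fun p hp => by
        have hp' : G p ≠ 0 := fun h => hp (by simp [h])
        have h2 := (hG p).2 hp'
        have h3 : 2 * R ≤ α := le_max_right _ _
        have hR : 0 ≤ R := (norm_nonneg _).trans h2.1
        have h4 := pi_div_two_le_phaseRadius T zero_le_one (Ω := 1)
        have h5 : 1 ≤ phaseRadius T 1 := by linarith [Real.pi_gt_three]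
        refine ⟨fun i => abs_le.1 ?_, ?_⟩
        · have h6 : |p.1 i| ≤ ‖p.1‖ := by simpa using PiLp.norm_apply_le p.1 i
          linarith
        · nlinarith
    rw [h1]
    simp_rw [mul_assoc]
    rw [integral_const_mul, ← hc, mul_inv_cancel_left₀ hc0.ne']
    exact happ z (subset_closure hz)

/-! ### Volume of the manifold and chart functions -/

theorem LipschitzOnWith.euclideanHausdorffMeasure_image_le {X Y : Type*} [EMetricSpace X]
    [EMetricSpace Y] [MeasurableSpace X] [BorelSpace X] [MeasurableSpace Y] [BorelSpace Y]
    {K : NNReal} {f : X → Y} {s : Set X} (h : LipschitzOnWith K f s) (d : ℕ) :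
    Measure.euclideanHausdorffMeasure d (f '' s) ≤
      (K : ENNReal) ^ (d : ℝ) * Measure.euclideanHausdorffMeasure d s := by
  simp only [Measure.euclideanHausdorffMeasure_def, Measure.smul_apply]
  rw [ENNReal.smul_def, ENNReal.smul_def, smul_eq_mul, smul_eq_mul, mul_left_comm]
  exact mul_le_mul' le_rfl (h.hausdorffMeasure_image_le d.cast_nonneg)

/-- An inverse chart is locally Lipschitz, so every point has a neighbourhood that is a Lipschitz
image of a bounded set; compactness then gives finite total volume. -/
theorem isFiniteMeasure_euclideanHausdorffMeasure_of_contMDiff {N d : ℕ} (M : Set (Euc N))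
    (hMc : IsCompact M) [ChartedSpace (Euc d) M] [IsManifold (𝓡 d) ∞ M]
    (hM : ContMDiff (𝓡 d) (𝓡 N) ∞ (Subtype.val : M → Euc N)) :
    IsFiniteMeasure (Measure.euclideanHausdorffMeasure d : Measure M) := by
  have : CompactSpace M := isCompact_iff_compactSpace.1 hMc
  refine ⟨isCompact_univ.measure_lt_top_of_nhdsWithin fun x _ => ?_⟩
  rw [nhdsWithin_univ]
  set e := extChartAt (𝓡 d) x
  have h1 : ContDiffOn ℝ ∞ (Subtype.val ∘ e.symm) e.target :=
    contMDiffOn_iff_contDiffOn.1 (hM.comp_contMDiffOn (contMDiffOn_extChartAt_symm x))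
  have hx : e.target ∈ 𝓝 (e x) := extChartAt_target_mem_nhds x
  obtain ⟨K, t, ht, hK⟩ := ((h1.contDiffAt hx).of_le (m := 1) (by norm_num)).exists_lipschitzOnWith
  set t' := t ∩ Metric.ball (e x) 1
  have ht' : t' ∈ 𝓝 (e x) := inter_mem ht (Metric.ball_mem_nhds _ one_pos)
  -- The distance on M is that of the ambient space, so the bound for the composite with the
  -- inclusion is a bound for `e.symm` itself.
  have hK' : LipschitzOnWith K e.symm t' := fun a ha b hb => hK ha.1 hb.1
  refine ⟨e.symm '' t', ?_, ?_⟩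
  · filter_upwards [(continuousAt_extChartAt x).preimage_mem_nhds ht',
      extChartAt_source_mem_nhds (I := 𝓡 d) x] with y hy hys
    exact ⟨e y, hy, e.left_inv hys⟩
  · refine (hK'.euclideanHausdorffMeasure_image_le d).trans_lt (ENNReal.mul_lt_top ?_ ?_)
    · exact ENNReal.rpow_lt_top_of_nonneg d.cast_nonneg ENNReal.coe_ne_top
    · rw [EuclideanSpace.euclideanHausdorffMeasure_eq_volume]
      exact (measure_mono Set.inter_subset_right).trans_lt measure_ball_lt_top

/-- The extension by zero is continuous because the function vanishes off φ(supp η), which is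
compact and hence closed in ℝ^d. -/
theorem continuous_chartFun {d : ℕ} {M : Type*} [TopologicalSpace M] [CompactSpace M]
    {f η : M → ℝ} (hf : Continuous f) (hη : Continuous η) (φ : OpenPartialHomeomorph M (Euc d))
    (hs : tsupport η ⊆ φ.source) : Continuous (chartFun f η φ) := by
  classical
  rw [continuous_iff_continuousAt]
  intro z
  by_cases hz : z ∈ φ.target
  · have h1 : ContinuousAt (fun z => f (φ.symm z) * η (φ.symm z)) z := by
      have h2 := φ.symm.continuousAt hz
      exact (hf.continuousAt.comp h2).mul (hη.continuousAt.comp h2)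
    refine h1.congr ?_
    filter_upwards [φ.open_target.mem_nhds hz] with y hy
    simp [chartFun, hy]
  · have hK : IsCompact (φ '' tsupport η) :=
      (isClosed_tsupport η).isCompact.image_of_continuousOn (φ.continuousOn.mono hs)
    have hz' : z ∈ (φ '' tsupport η)ᶜ := by
      rintro ⟨x, hx, rfl⟩
      exact hz (φ.map_source (hs hx))
    refine (continuousAt_const (y := (0 : ℝ))).congr ?_
    filter_upwards [hK.isClosed.isOpen_compl.mem_nhds hz'] with y hy
    rw [chartFun]
    split_ifs with hyt
    · have : η (φ.symm y) = 0 := by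
        by_contra h
        exact hy ⟨φ.symm y, subset_tsupport η h, φ.right_inv hyt⟩
      rw [this, mul_zero]
    · rfl

theorem chartFun_apply {d : ℕ} {M : Type*} [TopologicalSpace M] (f η : M → ℝ)
    (φ : OpenPartialHomeomorph M (Euc d)) {x : M} (hx : x ∈ φ.source) :
    chartFun f η φ (φ x) = f x * η x := by
  rw [chartFun, if_pos (φ.map_source hx), φ.left_inv hx]

/-! ### Measurability and second moments of a node -/

/-- The value at `z` of one node with inner weight and bias `p` and outer weight `g p`. -/
noncomputable def node {d : ℕ} (ρ : ℝ → ℝ) (g : Euc d × ℝ → ℝ) (z : Euc d) (p : Euc d × ℝ) : ℝ :=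
  g p * ρ (inner ℝ p.1 z + p.2)

/-- Since ρ is measurable only up to null sets, composing it with a random argument requires that
null sets pull back to null sets. -/
theorem IsDominatedLaw.quasiMeasurePreserving {d : ℕ} {Q : Measure (Euc d × ℝ)}
    (hQ : IsDominatedLaw Q) (z : Euc d) :
    Measure.QuasiMeasurePreserving (fun p : Euc d × ℝ => inner ℝ p.1 z + p.2) Q volume := by
  obtain ⟨c, μ, hc, hμ, hle⟩ := hQ
  have h1 : Measure.QuasiMeasurePreserving (fun p : Euc d × ℝ => inner ℝ p.1 z + p.2)
      (μ.prod volume) volume :=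
    Measure.quasiMeasurePreserving_snd.comp (measurePreserving_shear μ z).quasiMeasurePreserving
  exact h1.mono_left (Measure.absolutelyContinuous_of_le_smul hle)

theorem IsDominatedLaw.memLp_node {d : ℕ} {Q : Measure (Euc d × ℝ)} (hQ : IsDominatedLaw Q)
    {ρ : ℝ → ℝ} (hρ : MemLp ρ 2 volume) {g : Euc d × ℝ → ℝ} (hg : Measurable g) {C : ℝ}
    (hC : ∀ p, |g p| ≤ C) (z : Euc d) : MemLp (node ρ g z) 2 Q := by
  obtain ⟨c, μ, hc, hμ, hle⟩ := hQ
  have h := ((hρ.ridge μ z).smul_measure hc).mono_measure hle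
  refine h.of_le_mul (c := C) (hg.aestronglyMeasurable.mul h.1) (ae_of_all _ fun p => ?_)
  rw [node, norm_mul]
  exact mul_le_mul_of_nonneg_right (hC p) (norm_nonneg _)

/-- Under the dominating product measure the shear removes z from the integral of ρ², which leaves a
bound uniform in z. -/
theorem IsDominatedLaw.exists_integral_node_sq_le {d : ℕ} {Q : Measure (Euc d × ℝ)}
    (hQ : IsDominatedLaw Q)
    {ρ : ℝ → ℝ} (hρ : MemLp ρ 2 volume) {g : Euc d × ℝ → ℝ} (hg : Measurable g) {C : ℝ}
    (hC : ∀ p, |g p| ≤ C) : ∃ B : ℝ, ∀ z, ∫ p, node ρ g z p ^ 2 ∂Q ≤ B := by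
  have hQ' := hQ
  obtain ⟨c, μ, hc, hμ, hle⟩ := hQ
  refine ⟨C ^ 2 * (c.toReal * ∫ p : Euc d × ℝ, ρ p.2 ^ 2 ∂(μ.prod volume)), fun z => ?_⟩
  have h1 : MemLp (fun p : Euc d × ℝ => ρ (inner ℝ p.1 z + p.2)) 2 (c • μ.prod volume) :=
    (hρ.ridge μ z).smul_measure hc
  have h2 := h1.mono_measure hle
  calc ∫ p, node ρ g z p ^ 2 ∂Q ≤ ∫ p, C ^ 2 * ρ (inner ℝ p.1 z + p.2) ^ 2 ∂Q := by
        refine integral_mono (hQ'.memLp_node hρ hg hC z).integrable_sq (h2.integrable_sq.const_mul _)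
          fun p => ?_
        simp only [node, mul_pow]
        refine mul_le_mul_of_nonneg_right ?_ (sq_nonneg _)
        rw [← sq_abs]
        exact pow_le_pow_left₀ (abs_nonneg _) (hC p) 2
    _ = C ^ 2 * ∫ p, ρ (inner ℝ p.1 z + p.2) ^ 2 ∂Q := integral_const_mul _ _
    _ ≤ C ^ 2 * ∫ p, ρ (inner ℝ p.1 z + p.2) ^ 2 ∂(c • μ.prod volume) := by
        refine mul_le_mul_of_nonneg_left ?_ (sq_nonneg _)
        exact integral_mono_measure hle (ae_of_all _ fun p => sq_nonneg _) h1.integrable_sq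
    _ = _ := by
        rw [integral_smul_measure, smul_eq_mul]
        congr 2
        have h3 := measurePreserving_shear μ z
        have h4 := integral_map (μ := μ.prod volume) (f := fun p : Euc d × ℝ => ρ p.2 ^ 2)
          h3.measurable.aemeasurable (by
            rw [h3.map_eq]; exact ((hρ.comp_snd μ).1.pow 2))
        rw [h3.map_eq] at h4
        exact h4.symm

/-- Each z-section of the preimage of a null set is null, so by Tonelli the preimage is null in the
product. The random variable W is replaced by a measurable modification. -/
theorem IsDominatedLaw.aestronglyMeasurable_node {d : ℕ} {Q : Measure (Euc d × ℝ)}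
    (hQ : IsDominatedLaw Q) {ρ : ℝ → ℝ} (hρ : AEStronglyMeasurable ρ volume)
    {g : Euc d × ℝ → ℝ} (hg : Measurable g) {S Z : Type*} [MeasurableSpace S] [MeasurableSpace Z]
    {P : Measure S} [IsProbabilityMeasure P] {μ : Measure Z} [SFinite μ] {ψ : Z → Euc d}
    (hψ : Measurable ψ) {W : S → Euc d × ℝ} (hW : HasLaw W Q P) :
    AEStronglyMeasurable (fun q : S × Z => node ρ g (ψ q.2) (W q.1)) (P.prod μ) := by
  have hQp : IsProbabilityMeasure Q := hW.isProbabilityMeasure_iff.1 inferInstance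
  have hm : Measurable fun q : (Euc d × ℝ) × Z => inner ℝ q.1.1 (ψ q.2) + q.1.2 := by fun_prop
  have h1 : Measure.QuasiMeasurePreserving
      (fun q : (Euc d × ℝ) × Z => inner ℝ q.1.1 (ψ q.2) + q.1.2) (Q.prod μ) volume := by
    refine ⟨hm, Measure.AbsolutelyContinuous.mk fun A hA hA0 => ?_⟩
    rw [Measure.map_apply hm hA, Measure.prod_apply_symm (hm hA)]
    refine (lintegral_congr fun x => ?_).trans lintegral_zero
    exact (hQ.quasiMeasurePreserving (ψ x)).preimage_null hA0
  have h2 : AEStronglyMeasurable (fun q : (Euc d × ℝ) × Z => node ρ g (ψ q.2) q.1) (Q.prod μ) :=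
    (hg.comp measurable_fst).aestronglyMeasurable.mul (hρ.comp_quasiMeasurePreserving h1)
  have hW' : MeasurePreserving (hW.aemeasurable.mk W) P Q :=
    ⟨hW.aemeasurable.measurable_mk, by
      rw [← Measure.map_congr hW.aemeasurable.ae_eq_mk, hW.map_eq]⟩
  have h3 := h2.comp_quasiMeasurePreserving
    (hW'.prod (MeasurePreserving.id μ)).quasiMeasurePreserving
  refine h3.congr ?_
  have h4 := Measure.quasiMeasurePreserving_fst (μ := P) (ν := μ) |>.ae hW.aemeasurable.ae_eq_mk
  filter_upwards [h4] with q hq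
  simp [Prod.map, hq]

/-! ### Bias and variance of the random networks -/

/-- Bias-variance decomposition for a sum of independent random variables. -/
theorem integral_sq_sub_sum {S ι : Type*} [MeasurableSpace S] {P : Measure S}
    [IsProbabilityMeasure P] [Fintype ι] {Y : ι → S → ℝ} (hY : ∀ i, MemLp (Y i) 2 P)
    (hind : Pairwise fun i j => IndepFun (Y i) (Y j) P) (a : ℝ) :
    ∫ s, (a - ∑ i, Y i s) ^ 2 ∂P = (a - ∑ i, ∫ s, Y i s ∂P) ^ 2 + ∑ i, variance (Y i) P := by
  have hsum : MemLp (∑ i, Y i) 2 P := memLp_finsetSum' _ fun i _ => hY i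
  have hX : MemLp (fun s => a - (∑ i, Y i) s) 2 P := (memLp_const a).sub hsum
  have h1 := variance_eq_sub hX
  rw [variance_const_sub hsum.1, IndepFun.variance_sum (fun i _ => hY i)
    (fun i _ j _ hij => hind hij), integral_sub (integrable_const a)
    (hsum.integrable one_le_two)] at h1
  have h2 : ∫ s, (∑ i, Y i) s ∂P = ∑ i, ∫ s, Y i s ∂P := by
    simp only [Finset.sum_apply]
    exact integral_finsetSum _ fun i _ => (hY i).integrable one_le_two
  rw [h2] at h1
  simp only [integral_const, probReal_univ, one_smul, Pi.pow_apply, Finset.sum_apply] at h1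
  linarith

/-- The network with outer weights `g(w, b) / n`. -/
noncomputable def sampleMean {d : ℕ} {S : Type*} (ρ : ℝ → ℝ) (g : Euc d × ℝ → ℝ)
    (W : ℕ → S → Euc d × ℝ) (n : ℕ) (s : S) (z : Euc d) : ℝ :=
  ∑ k : Fin n, (n : ℝ)⁻¹ * node ρ g z (W k s)

/-- The difference is the total variance of all nodes of all charts: chart j contributes n_j terms,
each at most B_j/n_j². The factors χ_j will select the charts that contain a given point. -/
theorem abs_integral_sq_sub_sampleMean_le {d : ℕ} {J S : Type*} [Fintype J] [MeasurableSpace S]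
    {P : Measure S} [IsProbabilityMeasure P] {Q : J → Measure (Euc d × ℝ)}
    (hQ : ∀ j, IsDominatedLaw (Q j)) {W : J → ℕ → S → Euc d × ℝ}
    (hlaw : ∀ j k, HasLaw (W j k) (Q j) P) (hind : iIndepFun (fun p : J × ℕ => W p.1 p.2) P)
    {ρ : ℝ → ℝ} (hρ : MemLp ρ 2 volume) {g : J → Euc d × ℝ → ℝ} (hg : ∀ j, Measurable (g j))
    {C : J → ℝ} (hC : ∀ j p, |g j p| ≤ C j) {B : J → ℝ}
    (hB : ∀ j z, ∫ p, node ρ (g j) z p ^ 2 ∂(Q j) ≤ B j) {χ : J → ℝ} (hχ : ∀ j, χ j ^ 2 ≤ 1)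
    (z : J → Euc d) {n : J → ℕ} (hn : ∀ j, n j ≠ 0) (y : ℝ) :
    |∫ s, (y - ∑ j, χ j * sampleMean ρ (g j) (W j) (n j) s (z j)) ^ 2 ∂P
      - (y - ∑ j, χ j * ∫ p, node ρ (g j) (z j) p ∂(Q j)) ^ 2| ≤ ∑ j, B j / n j := by
  have hnode : ∀ j, MemLp (node ρ (g j) (z j)) 2 (Q j) := fun j =>
    (hQ j).memLp_node hρ (hg j) (hC j) (z j)
  let Y : (Σ j, Fin (n j)) → S → ℝ := fun i s =>
    χ i.1 * ((n i.1 : ℝ)⁻¹ * node ρ (g i.1) (z i.1) (W i.1 i.2 s))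
  have hYL : ∀ i, MemLp (Y i) 2 P := by
    intro i
    have h := hnode i.1
    rw [← (hlaw i.1 i.2).map_eq] at h
    exact ((h.comp_of_map (hlaw i.1 i.2).aemeasurable).const_mul _).const_mul _
  have hint : ∀ (i : Σ j, Fin (n j)) (F : Euc d × ℝ → ℝ), AEStronglyMeasurable F (Q i.1) →
      ∫ s, F (W i.1 i.2 s) ∂P = ∫ p, F p ∂(Q i.1) := fun i F hF =>
    (hlaw i.1 i.2).integral_comp hF
  have hYE : ∀ i, ∫ s, Y i s ∂P =
      χ i.1 * ((n i.1 : ℝ)⁻¹ * ∫ p, node ρ (g i.1) (z i.1) p ∂(Q i.1)) := by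
    intro i
    simp only [Y]
    rw [integral_const_mul, integral_const_mul, hint i _ (hnode i.1).1]
  have hYV : ∀ i, variance (Y i) P ≤ ((n i.1 : ℝ)⁻¹) ^ 2 * B i.1 := by
    intro i
    refine (variance_le_expectation_sq (hYL i).1).trans ?_
    simp only [Y, Pi.pow_apply, mul_pow]
    rw [integral_const_mul, integral_const_mul,
      hint i (fun p => node ρ (g i.1) (z i.1) p ^ 2) ((hnode i.1).1.pow 2)]
    have h1 : ((n i.1 : ℝ)⁻¹) ^ 2 * ∫ p, node ρ (g i.1) (z i.1) p ^ 2 ∂(Q i.1)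
        ≤ ((n i.1 : ℝ)⁻¹) ^ 2 * B i.1 := mul_le_mul_of_nonneg_left (hB _ _) (sq_nonneg _)
    exact (mul_le_of_le_one_left (mul_nonneg (sq_nonneg _)
      (integral_nonneg fun p => sq_nonneg _)) (hχ i.1)).trans h1
  have hYI : Pairwise fun i j => IndepFun (Y i) (Y j) P := by
    intro i i' hii
    have hne : ((i.1, (i.2 : ℕ)) : J × ℕ) ≠ (i'.1, (i'.2 : ℕ)) := by
      intro h
      apply hii
      obtain ⟨j, k⟩ := i
      obtain ⟨j', k'⟩ := i'
      simp only [Prod.mk.injEq] at h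
      obtain ⟨rfl, h⟩ := h
      rw [Fin.ext h]
    have h := hind.indepFun hne
    have hm : ∀ i : Σ j, Fin (n j), AEMeasurable (fun p => χ i.1 * ((n i.1 : ℝ)⁻¹ *
        node ρ (g i.1) (z i.1) p)) (P.map (W i.1 i.2)) := by
      intro i
      rw [(hlaw i.1 i.2).map_eq]
      exact ((hnode i.1).1.aemeasurable.const_mul _).const_mul _
    exact h.comp₀ (hlaw i.1 i.2).aemeasurable (hlaw i'.1 i'.2).aemeasurable (hm i) (hm i')
  have key := integral_sq_sub_sum hYL hYI y
  have e1 : ∀ s, ∑ i, Y i s = ∑ j, χ j * sampleMean ρ (g j) (W j) (n j) s (z j) := by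
    intro s
    rw [Fintype.sum_sigma]
    refine Finset.sum_congr rfl fun j _ => ?_
    simp only [Y, sampleMean, Finset.mul_sum]
  have hn' : ∀ j, (n j : ℝ) ≠ 0 := fun j => Nat.cast_ne_zero.2 (hn j)
  have e2 : ∑ i, ∫ s, Y i s ∂P = ∑ j, χ j * ∫ p, node ρ (g j) (z j) p ∂(Q j) := by
    rw [Fintype.sum_sigma]
    refine Finset.sum_congr rfl fun j _ => ?_
    simp only [hYE, Finset.sum_const, Finset.card_univ, Fintype.card_fin, nsmul_eq_mul]
    rw [mul_left_comm, mul_inv_cancel_left₀ (hn' j)]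
  simp only [e1, e2] at key
  rw [key, add_sub_cancel_left, abs_of_nonneg (Finset.sum_nonneg fun i _ => variance_nonneg _ _)]
  refine (Finset.sum_le_sum fun i _ => hYV i).trans_eq ?_
  rw [Fintype.sum_sigma]
  refine Finset.sum_congr rfl fun j _ => ?_
  simp only [Finset.sum_const, Finset.card_univ, Fintype.card_fin, nsmul_eq_mul]
  field_simp [hn' j]

/-- By Tonelli: the second moments of the sections are bounded uniformly, and μ is finite. -/
theorem memLp_node_prod {d : ℕ} {S Z : Type*} [MeasurableSpace S] [MeasurableSpace Z]
    {P : Measure S} [IsProbabilityMeasure P] {μ : Measure Z} [IsFiniteMeasure μ]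
    {Q : Measure (Euc d × ℝ)} (hQ : IsDominatedLaw Q) {W : S → Euc d × ℝ} (hW : HasLaw W Q P)
    {ρ : ℝ → ℝ} (hρ : MemLp ρ 2 volume) {g : Euc d × ℝ → ℝ} (hg : Measurable g)
    {C : ℝ} (hC : ∀ p, |g p| ≤ C) {ψ : Z → Euc d} (hψ : Measurable ψ) :
    MemLp (fun q : S × Z => node ρ g (ψ q.2) (W q.1)) 2 (P.prod μ) := by
  obtain ⟨B, hB⟩ := hQ.exists_integral_node_sq_le hρ hg hC
  have h1 := hQ.aestronglyMeasurable_node hρ.1 hg hψ hW (μ := μ)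
  have hz : ∀ z, MemLp (fun s => node ρ g z (W s)) 2 P := by
    intro z
    have h := hQ.memLp_node hρ hg hC z
    rw [← hW.map_eq] at h
    exact h.comp_of_map hW.aemeasurable
  have h2 : AEStronglyMeasurable (fun q : S × Z => node ρ g (ψ q.2) (W q.1) ^ 2) (P.prod μ) :=
    h1.pow 2
  rw [memLp_two_iff_integrable_sq h1, integrable_prod_iff' h2]
  refine ⟨ae_of_all _ fun x => (hz (ψ x)).integrable_sq, ?_⟩
  refine Integrable.of_bound h2.norm.prod_swap.integral_prod_right' B
    (ae_of_all _ fun x => ?_)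
  simp only [norm_pow, Real.norm_eq_abs, sq_abs]
  rw [abs_of_nonneg (integral_nonneg fun s => sq_nonneg _)]
  refine le_of_eq_of_le ?_ (hB (ψ x))
  exact hW.integral_comp (f := fun p => node ρ g (ψ x) p ^ 2)
    ((hQ.memLp_node hρ hg hC (ψ x)).1.pow 2)

/-- The mean squared error of a sum of random networks, integrated over a finite measure space,
is a squared bias plus a variance that decays with the numbers of nodes. -/
theorem sampleMean_error {d : ℕ} {J S Z : Type*} [Fintype J] [MeasurableSpace S]
    [MeasurableSpace Z] {P : Measure S} [IsProbabilityMeasure P] {μ : Measure Z}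
    [IsFiniteMeasure μ] {Q : J → Measure (Euc d × ℝ)}
    (hQ : ∀ j, IsDominatedLaw (Q j)) {W : J → ℕ → S → Euc d × ℝ}
    (hlaw : ∀ j k, HasLaw (W j k) (Q j) P) (hind : iIndepFun (fun p : J × ℕ => W p.1 p.2) P)
    {ρ : ℝ → ℝ} (hρ : MemLp ρ 2 volume) {g : J → Euc d × ℝ → ℝ} (hg : ∀ j, Measurable (g j))
    {C : J → ℝ} (hC : ∀ j p, |g j p| ≤ C j)
    {χ : J → Z → ℝ} (hχm : ∀ j, Measurable (χ j)) (hχ : ∀ j x, |χ j x| ≤ 1)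
    {ψ : J → Z → Euc d} (hψ : ∀ j, Measurable (ψ j)) {F : Z → ℝ} (hF : MemLp F 2 μ) {δ : ℝ}
    (hδ : ∀ᵐ x ∂μ, |F x - ∑ j, χ j x * ∫ p, node ρ (g j) (ψ j x) p ∂(Q j)| ≤ δ) :
    (∀ n : J → ℕ, Integrable (fun q : S × Z =>
      (F q.2 - ∑ j, χ j q.2 * sampleMean ρ (g j) (W j) (n j) q.1 (ψ j q.2)) ^ 2) (P.prod μ)) ∧
    ∃ c ≤ δ ^ 2 * μ.real Set.univ, ∃ B : J → ℝ, ∀ n : J → ℕ, (∀ j, n j ≠ 0) →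
      |∫ s, ∫ x, (F x - ∑ j, χ j x * sampleMean ρ (g j) (W j) (n j) s (ψ j x)) ^ 2 ∂μ ∂P - c| ≤
        ∑ j, B j / n j := by
  choose B hB using fun j => (hQ j).exists_integral_node_sq_le hρ (hg j) (hC j)
  have hnode : ∀ j k, MemLp (fun q : S × Z => node ρ (g j) (ψ j q.2) (W j k q.1)) 2 (P.prod μ) :=
    fun j k => memLp_node_prod (hQ j) (hlaw j k) hρ (hg j) (hC j) (hψ j)
  have hint : ∀ n : J → ℕ, Integrable (fun q : S × Z =>
      (F q.2 - ∑ j, χ j q.2 * sampleMean ρ (g j) (W j) (n j) q.1 (ψ j q.2)) ^ 2) (P.prod μ) := by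
    intro n
    refine MemLp.integrable_sq ((hF.comp_snd P).sub (memLp_finsetSum _ fun j _ => ?_))
    have h1 : MemLp (fun q : S × Z => sampleMean ρ (g j) (W j) (n j) q.1 (ψ j q.2)) 2
        (P.prod μ) := memLp_finsetSum _ fun k _ => (hnode j k).const_mul _
    refine h1.of_le_mul (c := 1)
      (((hχm j).comp measurable_snd).aestronglyMeasurable.mul h1.1) (ae_of_all _ fun q => ?_)
    rw [norm_mul]
    exact mul_le_mul_of_nonneg_right (hχ j q.2) (norm_nonneg _)
  set H : Z → ℝ := fun x => ∑ j, χ j x * ∫ p, node ρ (g j) (ψ j x) p ∂(Q j) with hH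
  have hHm : AEStronglyMeasurable H μ := by
    refine Finset.aestronglyMeasurable_fun_sum _ fun j _ =>
      (hχm j).aestronglyMeasurable.mul ?_
    -- The mean is the expectation of the node with index 0, so its measurability in x follows from
    -- joint measurability of that node.
    refine (hnode j 0).1.prod_swap.integral_prod_right'.congr (ae_of_all _ fun x => ?_)
    exact (hlaw j 0).integral_comp ((hQ j).memLp_node hρ (hg j) (hC j) (ψ j x)).1
  have hFH : ∀ᵐ x ∂μ, ‖(F x - H x) ^ 2‖ ≤ δ ^ 2 := by
    filter_upwards [hδ] with x hx
    rw [norm_pow, Real.norm_eq_abs]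
    exact pow_le_pow_left₀ (abs_nonneg _) hx 2
  have hFHi : Integrable (fun x => (F x - H x) ^ 2) μ :=
    Integrable.of_bound ((hF.1.sub hHm).pow 2) (δ ^ 2) hFH
  refine ⟨hint, ∫ x, (F x - H x) ^ 2 ∂μ, ?_, fun j => μ.real Set.univ * B j, fun n hn => ?_⟩
  · exact (le_abs_self _).trans (norm_integral_le_of_norm_le_const hFH)
  · rw [integral_integral_swap (hint n), ← integral_sub (hint n).integral_prod_right hFHi]
    have h1 := norm_integral_le_of_norm_le_const (μ := μ) (C := ∑ j, B j / n j)
      (f := fun x => ∫ s, (F x - ∑ j, χ j x * sampleMean ρ (g j) (W j) (n j) s (ψ j x)) ^ 2 ∂P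
        - (F x - H x) ^ 2) (ae_of_all _ fun x =>
      abs_integral_sq_sub_sampleMean_le hQ hlaw hind hρ hg hC hB (χ := fun j => χ j x)
        (fun j => by rw [← sq_abs]; exact pow_le_one₀ (abs_nonneg _) (hχ j x))
        (fun j => ψ j x) hn (F x))
    refine h1.trans_eq ?_
    rw [Finset.sum_mul]
    exact Finset.sum_congr rfl fun j _ => by ring

/-! ### Limits and rates -/

theorem tendstoBelowAtRate_of_abs_sub_le {ι : Type*} {l : Filter ι} {e b r : ι → ℝ} {c ε K : ℝ}
    (hc : c < ε) (hb : Tendsto b l (𝓝 0)) (h : ∀ᶠ i in l, |e i - c| ≤ b i)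
    (hr : ∀ᶠ i in l, b i ≤ K * ‖r i‖) : TendstoBelowAtRate l e r ε := by
  refine ⟨c, hc, ?_, Asymptotics.IsBigO.of_bound K ?_⟩
  · rw [tendsto_iff_dist_tendsto_zero]
    refine squeeze_zero' (Eventually.of_forall fun i => dist_nonneg) ?_ hb
    simpa only [Real.dist_eq] using h
  · filter_upwards [h, hr] with i h1 h2 using h1.trans h2

theorem tendstoBelowAtRate_one_div_nat {e : ℕ → ℝ} {c ε B : ℝ} (hc : c < ε)
    (h : ∀ n, n ≠ 0 → |e n - c| ≤ B / n) :
    TendstoBelowAtRate atTop e (fun n : ℕ => 1 / (n : ℝ)) ε := by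
  refine tendstoBelowAtRate_of_abs_sub_le (K := B) hc (tendsto_const_div_atTop_nhds_zero_nat B)
    ?_ (Eventually.of_forall fun n => ?_)
  · filter_upwards [eventually_ne_atTop 0] with n hn using h n hn
  · rw [Real.norm_of_nonneg (by positivity), mul_one_div]

theorem tendstoBelowAtRate_one_div_iInf {J : Type*} [Fintype J] {e : (J → ℕ) → ℝ} {c ε : ℝ}
    {B : J → ℝ} (hc : c < ε) (h : ∀ n : J → ℕ, (∀ j, n j ≠ 0) → |e n - c| ≤ ∑ j, B j / n j) :
    TendstoBelowAtRate atTop e (fun n : J → ℕ => 1 / ⨅ j, (n j : ℝ)) ε := by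
  have hev : ∀ᶠ n : J → ℕ in atTop, ∀ j, n j ≠ 0 := by
    filter_upwards [eventually_ge_atTop (fun _ : J => 1)] with n hn j
    have := hn j
    simp only at this
    omega
  have hj : ∀ j, Tendsto (fun n : J → ℕ => n j) atTop atTop := fun j =>
    tendsto_atTop_atTop.2 fun b => ⟨fun _ => b, fun n hn => hn j⟩
  refine tendstoBelowAtRate_of_abs_sub_le (K := ∑ j, |B j|) hc (b := fun n => ∑ j, B j / n j) ?_
    (hev.mono h) ?_
  · rw [← Finset.sum_const_zero (s := (Finset.univ : Finset J))]
    exact tendsto_finsetSum _ fun j _ => (tendsto_const_div_atTop_nhds_zero_nat (B j)).comp (hj j)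
  · filter_upwards [hev] with n hn
    rw [Finset.sum_mul]
    refine Finset.sum_le_sum fun j _ => ?_
    -- With an index j at hand the infimum is an attained minimum, hence positive. For empty J there
    -- is no summand to bound.
    have : Nonempty J := ⟨j⟩
    obtain ⟨i, hi⟩ := exists_eq_ciInf_of_finite (f := fun j => (n j : ℝ))
    have hpos : 0 < ⨅ j, (n j : ℝ) := by
      rw [← hi]
      exact Nat.cast_pos.2 (Nat.pos_of_ne_zero (hn i))
    have hle : ⨅ j, (n j : ℝ) ≤ n j := ciInf_le (Set.finite_range _).bddBelow j
    rw [Real.norm_of_nonneg (by positivity), mul_one_div]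
    exact (div_le_div_of_nonneg_right (le_abs_self _) (Nat.cast_nonneg _)).trans
      (div_le_div_of_nonneg_left (abs_nonneg _) hpos hle)

/-! ### Assembly of the theorem -/

theorem exists_sq_mul_lt {A ε : ℝ} (hA : 0 ≤ A) (hε : 0 < ε) : ∃ δ > 0, δ ^ 2 * A < ε := by
  refine ⟨√(ε / (A + 1)), by positivity, ?_⟩
  rw [Real.sq_sqrt (by positivity), div_mul_eq_mul_div, div_lt_iff₀ (by positivity)]
  nlinarith

theorem rvfl_eq_sampleMean {d : ℕ} {S : Type*} (ρ : ℝ → ℝ) (α : ℝ) (w y : ℕ → S → Euc d)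
    (u : ℕ → S → ℝ) (g : Euc d × ℝ → ℝ) (n : ℕ) (s : S) (z : Euc d) :
    rvfl ρ α w y u n (fun wb k => (n : ℝ)⁻¹ * g (wb k)) s z =
      sampleMean ρ g (fun k s => (w k s, bias α (w k s) (y k s) (u k s))) n s z := by
  simp only [rvfl, network, sampleMean, node, mul_assoc]

theorem IsRandomSample.hasLaw_innerLaw {d : ℕ} {J S : Type*} [MeasurableSpace S] {P : Measure S}
    {T : J → Set (Euc d)} {α Ω : J → ℝ} {w y : J → ℕ → S → Euc d} {u : J → ℕ → S → ℝ}
    (h : IsRandomSample P T α Ω w y u) (j : J) (k : ℕ) :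
    HasLaw (fun s => (w j k s, bias (α j) (w j k s) (y j k s) (u j k s)))
      (innerLaw (T j) (α j) (Ω j)) P :=
  (HasLaw.mk (measurable_bias (α j)).aemeasurable rfl).comp (h.law j k)

theorem IsRandomSample.iIndepFun_inner {d : ℕ} {J S : Type*} [MeasurableSpace S] {P : Measure S}
    {T : J → Set (Euc d)} {α Ω : J → ℝ} {w y : J → ℕ → S → Euc d} {u : J → ℕ → S → ℝ}
    (h : IsRandomSample P T α Ω w y u) :
    iIndepFun (fun (p : J × ℕ) (s : S) => (w p.1 p.2 s,
      bias (α p.1) (w p.1 p.2 s) (y p.1 p.2 s) (u p.1 p.2 s))) P :=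
  h.indep.comp (fun p t => (t.1, bias (α p.1) t.1 t.2.1 t.2.2)) fun p => measurable_bias (α p.1)

theorem mainTheorem3
    {N d : ℕ}
    -- a compact smooth embedded submanifold `M` of `ℝ^N` of dimension `d`
    (M : Set (Euc N)) (hMc : IsCompact M)
    [ChartedSpace (Euc d) M] [IsManifold (𝓡 d) ∞ M]
    (hM : Manifold.IsSmoothEmbedding (𝓡 d) (𝓡 N) ∞ (Subtype.val : M → Euc N))
    -- a finite atlas of charts with bounded images
    {J : Type*} [Fintype J] (φ : J → OpenPartialHomeomorph M (Euc d))
    (hcover : ∀ x : M, ∃ j, x ∈ (φ j).source)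
    (hbdd : ∀ j, Bornology.IsBounded (φ j).target)
    -- a partition of unity subordinate to the atlas
    (η : PartitionOfUnity J M) (hη : η.IsSubordinate (fun j => (φ j).source))
    (f : C(M, ℝ))
    -- the activation function
    (ρ : ℝ → ℝ) (hρ1 : MemLp ρ 1 volume) (hρ2 : MemLp ρ 2 volume)
    (hρ0 : ¬ ρ =ᵐ[volume] 0)
    (ε : ℝ) (hε : 0 < ε) :
    ∃ α Ω : J → ℝ, (∀ j, 0 < α j ∧ 0 < Ω j) ∧
      -- the outer weights of the network with `n` nodes on the chart `j`,
      -- as functions of the inner weights and biases of that network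
      ∃ v : J → (n : ℕ) → (Fin n → Euc d × ℝ) → Fin n → ℝ,
        (∀ j n, Measurable (v j n)) ∧
        ∀ (S : Type*) [MeasurableSpace S] (P : Measure S) [IsProbabilityMeasure P]
          (w y : J → ℕ → S → Euc d) (u : J → ℕ → S → ℝ),
          IsRandomSample P (fun j => (φ j).target) α Ω w y u →
          -- each network approximates its chart function on `φ_j(U_j)`
          (∀ j,
            (∀ n : ℕ, Integrable
              (fun p : S × Euc d => chartSqError ρ (α j) (w j) (y j) (u j) n (v j n)
                (chartFun f (η j) (φ j)) p.1 p.2)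
              (P.prod ((volume : Measure (Euc d)).restrict (φ j).target))) ∧
            TendstoBelowAtRate atTop
              (fun n : ℕ => ∫ s, (∫ z in (φ j).target,
                chartSqError ρ (α j) (w j) (y j) (u j) n (v j n)
                  (chartFun f (η j) (φ j)) s z) ∂P)
              (fun n : ℕ => 1 / (n : ℝ)) ε) ∧
          -- the sum of the networks approximates `f` on `M`, with respect to the volume of `M`
          (∀ n : J → ℕ, Integrable
            (fun p : S × M => manifoldSqError φ ρ α w y u n (fun j => v j (n j)) f p.1 p.2)
            (P.prod (Measure.euclideanHausdorffMeasure d : Measure M))) ∧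
          TendstoBelowAtRate atTop
            (fun n : J → ℕ => ∫ s, (∫ x : M,
              manifoldSqError φ ρ α w y u n (fun j => v j (n j)) f s x
                ∂(Measure.euclideanHausdorffMeasure d)) ∂P)
            (fun n : J → ℕ => 1 / ⨅ j, (n j : ℝ)) ε := by
  classical
  have : CompactSpace M := isCompact_iff_compactSpace.1 hMc
  have hfin := isFiniteMeasure_euclideanHausdorffMeasure_of_contMDiff M hMc hM.contMDiff
  set μM : Measure M := Measure.euclideanHausdorffMeasure d
  set T : J → Set (Euc d) := fun j => (φ j).target with hT
  set fhat : J → Euc d → ℝ := fun j => chartFun f (η j) (φ j) with hfhat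
  have hcont : ∀ j, Continuous (fhat j) := fun j =>
    continuous_chartFun f.continuous (η j).continuous (φ j) (hη j)
  -- One δ serves both parts: A dominates every chart volume and also |J|² times the volume of M,
  -- because up to |J| chart biases add up at a point.
  obtain ⟨δ, hδ0, hδ⟩ := exists_sq_mul_lt (ε := ε)
    (A := ∑ j, volume.real (T j) + (Fintype.card J : ℝ) ^ 2 * μM.real Set.univ)
    (by positivity) hε
  have hδT : ∀ j, δ ^ 2 * volume.real (T j) < ε := fun j => by
    refine lt_of_le_of_lt (mul_le_mul_of_nonneg_left ?_ (sq_nonneg δ)) hδ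
    have := Finset.single_le_sum (f := fun j => volume.real (T j))
      (fun i _ => measureReal_nonneg) (Finset.mem_univ j)
    have h2 : 0 ≤ (Fintype.card J : ℝ) ^ 2 * μM.real Set.univ := by positivity
    linarith
  have hδM : (Fintype.card J * δ) ^ 2 * μM.real Set.univ < ε := by
    have : 0 ≤ δ ^ 2 * ∑ j, volume.real (T j) := by positivity
    nlinarith
  have hρi : Integrable ρ := memLp_one_iff_integrable.1 hρ1
  choose α hα g C hg hC happ using fun j =>
    exists_outer_weight hρi hρ0 (φ j).open_target (hbdd j) (hcont j) hδ0
  refine ⟨α, fun _ => 1, fun j => ⟨hα j, one_pos⟩, fun j n wb k => (n : ℝ)⁻¹ * g j (wb k),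
    fun j n => measurable_pi_lambda _ fun k => ((hg j).comp (measurable_pi_apply k)).const_mul _,
    fun S _ P _ w y u hsample => ?_⟩
  have hlaw := hsample.hasLaw_innerLaw
  have hind := hsample.iIndepFun_inner
  have hQ : ∀ j, IsDominatedLaw (innerLaw (T j) (α j) 1) := fun j =>
    isDominatedLaw_innerLaw (T j) (hα j) one_pos
  refine ⟨fun j => ?_, ?_⟩
  · have : IsFiniteMeasure ((volume : Measure (Euc d)).restrict (T j)) :=
      ⟨by simpa using (hbdd j).measure_lt_top⟩
    have hF : MemLp (fhat j) 2 ((volume : Measure (Euc d)).restrict (T j)) := by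
      refine MemLp.of_bound (hcont j).aestronglyMeasurable ‖f‖ (ae_of_all _ fun z => ?_)
      simp only [hfhat, chartFun]
      split_ifs
      · rw [norm_mul, Real.norm_of_nonneg ((η.nonneg j _))]
        exact (mul_le_of_le_one_right (norm_nonneg _) (η.le_one j _)).trans
          (f.norm_coe_le_norm _)
      · simp
    -- A single network is the case of a one-element index set, with trivial cutoff and identity
    -- chart.
    obtain ⟨hi, c, hc, B, hB⟩ := sampleMean_error (J := Unit) (Z := Euc d) (fun _ => hQ j)
      (fun _ => hlaw j) (hind.precomp (g := fun p : Unit × ℕ => (j, p.2)) (by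
        rintro ⟨⟨⟩, k⟩ ⟨⟨⟩, k'⟩ h
        simpa using h)) hρ2 (fun _ => hg j) (fun _ => hC j) (χ := fun _ _ => 1)
      (fun _ => measurable_const) (fun _ _ => by simp) (ψ := fun _ z => z)
      (fun _ => measurable_id) hF (δ := δ) (by
        filter_upwards [ae_restrict_mem (φ j).open_target.measurableSet] with z hz
        simpa [node] using (happ j z hz).le)
    simp only [Finset.univ_unique, one_mul, Finset.sum_singleton] at hi hB
    simp only [chartSqError, rvfl_eq_sampleMean, sq_abs]
    refine ⟨fun n => hi fun _ => n, tendstoBelowAtRate_one_div_nat (c := c) (B := B ()) ?_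
      fun n hn => hB (fun _ => n) fun _ => hn⟩
    refine hc.trans_lt ?_
    rw [measureReal_restrict_apply_univ]
    exact hδT j
  -- Indicators turn the sum over charts containing x into a sum over all of J, and extending φ_j by
  -- 0 makes it a measurable map on M.
  · set χ : J → M → ℝ := fun j => (φ j).source.indicator 1 with hχ
    set ψ : J → M → Euc d := fun j => (φ j).source.piecewise (φ j) 0 with hψ
    have hsum : ∀ (G : J → Euc d → ℝ) (x : M), chartSum φ G x = ∑ j, χ j x * G j (ψ j x) := by
      intro G x
      rw [chartSum, Finset.sum_filter]
      refine Finset.sum_congr rfl fun j _ => ?_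
      by_cases hx : x ∈ (φ j).source <;> simp [hχ, hψ, hx]
    have hF : MemLp f 2 μM := MemLp.of_bound f.continuous.aestronglyMeasurable ‖f‖
      (ae_of_all _ fun x => f.norm_coe_le_norm x)
    have hfsum : ∀ x, f x = ∑ j, χ j x * fhat j (ψ j x) := by
      intro x
      have h1 := η.sum_eq_one (Set.mem_univ x)
      rw [finsum_eq_sum_of_fintype] at h1
      -- Expand f as the sum of f η_j. A term with x outside U_j vanishes by subordination, in
      -- agreement with the cutoff.
      rw [← mul_one (f x), ← h1, Finset.mul_sum]
      refine Finset.sum_congr rfl fun j _ => ?_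
      by_cases hx : x ∈ (φ j).source
      · simp [hχ, hψ, hx, hfhat, chartFun_apply]
      · have : η j x = 0 := by
          by_contra h0
          exact hx (hη j (subset_tsupport _ h0))
        simp [hχ, hx, this]
    obtain ⟨hi, c, hc, B, hB⟩ := sampleMean_error hQ hlaw hind hρ2 hg hC (χ := χ)
      (fun j => measurable_one.indicator (φ j).open_source.measurableSet)
      (fun j x => by by_cases hx : x ∈ (φ j).source <;> simp [hχ, hx])
      (ψ := ψ) (fun j => (φ j).continuousOn.measurable_piecewise continuousOn_const
        (φ j).open_source.measurableSet) hF (δ := Fintype.card J * δ) (ae_of_all _ fun x => by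
        rw [hfsum x, ← Finset.sum_sub_distrib, ← nsmul_eq_mul]
        refine (Finset.abs_sum_le_sum_abs _ _).trans (Finset.sum_le_card_nsmul _ _ _ fun j _ => ?_)
        by_cases hx : x ∈ (φ j).source
        · simpa [hχ, hψ, hx, node] using (happ j _ ((φ j).map_source hx)).le
        · simpa [hχ, hx] using hδ0.le)
    simp only [manifoldSqError, rvfl_eq_sampleMean, sq_abs, hsum]
    exact ⟨hi, tendstoBelowAtRate_one_div_iInf (hc.trans_lt hδM) hB⟩
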